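/- Let $q,d\ge 3$ be integers. For $\ell\ge 0$ let $G_{\ell;d}$ be the $\ell$-th Gegenbauer polynomial, i.e. the Jacobi polynomial $P_\ell^{(d/2-1,\,d/2-1)}$ normalized so that $G_{\ell;d}(1)=1$, and let $J_{d/2-1}$ be the Bessel function of the first kind of order $d/2-1$. The integral $$\int_0^{\infty} J_{\frac d2-1}(\psi)^q\,\psi^{-q\left(\frac d2-1\right)+d-1}\,d\psi=\lim_{R\to\infty}\int_0^{R} J_{\frac d2-1}(\psi)^q\,\psi^{-q\left(\frac d2-1\right)+d-1}\,d\psi$$ converges; it converges absolutely if $(d,q)\neq(3,3)$, and only conditionally if $d=q=3$. Put $$c_{q;d}=\left(2^{\frac d2-1}\left(\tfrac d2-1\right)!\right)^q\int_0^{\infty} J_{\frac d2-1}(\psi)^q\,\psi^{-q\left(\frac d2-1\right)+d-1}\,d\psi,\qquad \left(\tfrac d2-1\right)!=\Gamma\left(\tfrac d2\right).$$ Then, as $\ell\to\infty$ (with $q$ and $d$ fixed), $$\int_0^{\pi/2} G_{\ell;d}(\cos\vartheta)^q(\sin\vartheta)^{d-1}\,d\vartheta=\frac{c_{q;d}}{\ell^{d}}\,\bigl(1+o(1)\bigr).$$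 -/

import Mathlib

open Set Filter Topology MeasureTheory Asymptotics
open scoped Nat

/-- The Jacobi polynomial `P_n^{(α,β)}`, as a function of a real variable:
`P_n^{(α,β)}(t) = ∑_{k=0}^n (n+α+β+1)_k (α+k+1)_{n-k} / (k! (n-k)!) ((t-1)/2)^k`,
where `(x)_k = x (x+1) ⋯ (x+k-1)`. -/
noncomputable def jacobiP (α β : ℝ) (n : ℕ) (t : ℝ) : ℝ :=
  ∑ k ∈ Finset.range (n + 1),
    (ascPochhammer ℝ k).eval (n + α + β + 1) * (ascPochhammer ℝ (n - k)).eval (α + k + 1) /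
      (k ! * (n - k)!) * ((t - 1) / 2) ^ k

/-- The Gegenbauer polynomial `G_{ℓ;d}`: the Jacobi polynomial with both parameters equal to
`d/2 - 1`, normalized so that its value at `1` is `1`. -/
noncomputable def gegenbauerG (ℓ d : ℕ) (t : ℝ) : ℝ :=
  jacobiP ((d : ℝ) / 2 - 1) ((d : ℝ) / 2 - 1) ℓ t / jacobiP ((d : ℝ) / 2 - 1) ((d : ℝ) / 2 - 1) ℓ 1

/-- The value `P_n^{(α,β)}(1) = (α+1)_n / n!`, that is, the binomial coefficient of `n+α` over `n`. -/
theorem jacobiP_one (α β : ℝ) (n : ℕ) :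
    jacobiP α β n 1 = (ascPochhammer ℝ n).eval (α + 1) / n ! := by
  unfold jacobiP
  rw [Finset.sum_eq_single 0]
  · simp
  · intro k _ hk
    simp [hk]
  · simp

/-- The normalization of `G_{ℓ;d}` is meaningful. -/
theorem gegenbauerG_one (ℓ d : ℕ) (hd : 1 ≤ d) : gegenbauerG ℓ d 1 = 1 := by
  unfold gegenbauerG
  apply div_self
  rw [jacobiP_one]
  have h : (0 : ℝ) < (d : ℝ) / 2 - 1 + 1 := by
    have : (1 : ℝ) ≤ d := by exact_mod_cast hd
    linarith
  have h2 := ascPochhammer_pos ℓ _ h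
  positivity

/-- The Bessel function of the first kind of real order `ν`, at `x > 0`:
`J_ν(x) = ∑_{m ≥ 0} (-1)^m / (m! Γ(m+ν+1)) (x/2)^{2m+ν}`. -/
noncomputable def besselJ (ν x : ℝ) : ℝ :=
  ∑' m : ℕ, (-1) ^ m / (m ! * Real.Gamma (m + ν + 1)) * (x / 2) ^ (2 * (m : ℝ) + ν)

/-- The integral `∫_0^∞ f` converges to `I` as an improper integral at infinity:
`f` is integrable on every `(0, R]`, and `∫_0^R f → I` as `R → ∞`. -/
def HasImproperIntegral (f : ℝ → ℝ) (I : ℝ) : Prop :=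
  (∀ R : ℝ, IntegrableOn f (Ioc 0 R)) ∧ Tendsto (fun R : ℝ => ∫ x in (0)..R, f x) atTop (𝓝 I)

/-- The integral `∫_0^∞ f` converges absolutely. -/
def ConvergesAbsolutely (f : ℝ → ℝ) : Prop :=
  IntegrableOn f (Ioi 0)

/-- The integral `∫_0^∞ f` converges conditionally: it converges as an improper integral, but not
absolutely. -/
def ConvergesConditionally (f : ℝ → ℝ) : Prop :=
  (∃ I : ℝ, HasImproperIntegral f I) ∧ ¬ ConvergesAbsolutely f

/-- The integrand `J_{d/2-1}(ψ)^q ψ^{-q(d/2-1)+d-1}`. -/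
noncomputable def besselIntegrand (q d : ℕ) (ψ : ℝ) : ℝ :=
  besselJ ((d : ℝ) / 2 - 1) ψ ^ q * ψ ^ (-(q : ℝ) * ((d : ℝ) / 2 - 1) + d - 1)

/-- The improper integral `∫_0^∞ f = lim_{R → ∞} ∫_0^R f` (meaningful when it converges). -/
noncomputable def improperIntegral (f : ℝ → ℝ) : ℝ :=
  limUnder atTop (fun R : ℝ => ∫ x in (0)..R, f x)

/-- The constant `c_{q;d} = (2^{d/2-1} (d/2-1)!)^q ∫_0^∞ J_{d/2-1}(ψ)^q ψ^{-q(d/2-1)+d-1} dψ`,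
where `(d/2-1)! = Γ(d/2)`. -/
noncomputable def cConst (q d : ℕ) : ℝ :=
  ((2 : ℝ) ^ ((d : ℝ) / 2 - 1) * Real.Gamma ((d : ℝ) / 2)) ^ q *
    improperIntegral (besselIntegrand q d)

/-! Put `a = d/2`, `k = d - 1 = 2a - 1`, and let `besselB a (x²)` be the Bessel function
`J_{a-1}(x)` divided by its leading term at `0`. Substituting `θ = ψ/n` turns `n^d` times the
Gegenbauer moment into an integral over `(0, nπ/2]` whose integrand tends pointwise to `besselB a
(ψ²)^q ψ^k`, by the Mehler–Heine formula (`tendsto_gegAngle_div`).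

Domination rests on two bounds on `[0, π/2]`, uniform in `n ≥ 1`: `|G| ≤ 1`, from a decreasing
energy, and `G² (nθ)^k ≤ const`, from the monotone Sonin function of the Liouville normal form
(`gegAngle_sq_mul_le`). Both pass to the Bessel limit. The resulting majorant decays like `ψ^(k -
kq/2)`, which is integrable at infinity unless `q = 3`, `k = 2`.

The relation `~` also needs a nonzero constant. For `a = d/2`, `besselB a` is the Fourier transform
of the uniform measure on the unit sphere of `ℝ^d`, so the integral is, up to a positive factor, a
value of the density of a random walk with unit steps. Analytically, the product formula
(`besselB_product_formula`) expresses each Gaussian-regularized Hankel transform as an average of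
the preceding one. Starting from a Gaussian, this gives a positive lower bound independent of the
regularization (`exists_hankelGauss_ge`), which survives its removal.

For `d = q = 3` everything is elementary: `sin θ · G = sin((n+1)θ)/(n+1)` and `besselB (3/2) (x²) =
sin x / x`. Replacing `1/sin θ` by `1/θ` costs an error killed by the Riemann–Lebesgue lemma, and
the moments at odd frequencies are exactly `π/4`. -/

/-! ### Rising factorials and the normalized Bessel function -/

/-- The rising factorial `(a)_m = a (a + 1) ⋯ (a + m - 1)`. -/
noncomputable def poch (a : ℝ) (m : ℕ) : ℝ := (ascPochhammer ℝ m).eval a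

theorem poch_zero (a : ℝ) : poch a 0 = 1 := by simp [poch]

theorem poch_succ (a : ℝ) (m : ℕ) : poch a (m + 1) = poch a m * (a + m) := by
  simp [poch, ascPochhammer_succ_eval]

theorem poch_succ_left (a : ℝ) (m : ℕ) : poch a (m + 1) = a * poch (a + 1) m := by
  simp [poch, ascPochhammer_succ_left]

theorem one_le_poch {a : ℝ} (ha : 1 ≤ a) (m : ℕ) : 1 ≤ poch a m := by
  induction m with
  | zero => simp [poch_zero]
  | succ k ih =>
    rw [poch_succ]
    have : (0 : ℝ) ≤ k := k.cast_nonneg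
    nlinarith

theorem poch_pos {a : ℝ} (ha : 1 ≤ a) (m : ℕ) : 0 < poch a m :=
  lt_of_lt_of_le one_pos (one_le_poch ha m)

theorem Gamma_add_nat {a : ℝ} (ha : 0 < a) (m : ℕ) :
    Real.Gamma (a + m) = poch a m * Real.Gamma a := by
  induction m with
  | zero => simp [poch_zero]
  | succ k ih =>
    have : a + k ≠ 0 := by positivity
    rw [poch_succ]
    push_cast
    rw [← add_assoc, Real.Gamma_add_one this, ih]
    ring

/-- The terms of the power series of the normalized Bessel function. -/
noncomputable def besselTerm (a : ℝ) (m : ℕ) (s : ℝ) : ℝ := (-s / 4) ^ m / (m ! * poch a m)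

/-- The normalized Bessel function `s ↦ ₀F₁(; a; -s/4)`, so that
`J_{a-1}(x) = (x/2)^(a-1) / Γ(a) * besselB a (x^2)`. -/
noncomputable def besselB (a s : ℝ) : ℝ := ∑' m, besselTerm a m s

theorem abs_besselTerm_le {a : ℝ} (ha : 1 ≤ a) (m : ℕ) (s : ℝ) :
    |besselTerm a m s| ≤ |s| ^ m / m ! := by
  have h1 := one_le_poch ha m
  have hf : (0 : ℝ) < m ! := by positivity
  have h2 := poch_pos ha m
  rw [besselTerm, abs_div, abs_pow, abs_of_pos (a := (m ! : ℝ) * poch a m) (by positivity)]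
  apply div_le_div₀ (by positivity) _ hf (by nlinarith)
  apply pow_le_pow_left₀ (abs_nonneg _)
  rw [abs_div, abs_neg, abs_of_pos (by norm_num : (0 : ℝ) < 4)]
  linarith [abs_nonneg s]

theorem summable_besselTerm {a : ℝ} (ha : 1 ≤ a) (s : ℝ) :
    Summable fun m => besselTerm a m s :=
  Summable.of_norm_bounded (Real.summable_pow_div_factorial |s|)
    (fun m => by simpa using abs_besselTerm_le ha m s)

theorem hasSum_besselB {a : ℝ} (ha : 1 ≤ a) (s : ℝ) :
    HasSum (fun m => besselTerm a m s) (besselB a s) :=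
  (summable_besselTerm ha s).hasSum

theorem besselB_zero (a : ℝ) : besselB a 0 = 1 := by
  unfold besselB
  rw [tsum_eq_single 0]
  · simp [besselTerm, poch_zero]
  · intro m hm
    simp [besselTerm, hm]

/-- The derivative of the terms. -/
noncomputable def besselTermDeriv (a : ℝ) (m : ℕ) (s : ℝ) : ℝ :=
  m * (-s / 4) ^ (m - 1) * (-1 / 4) / (m ! * poch a m)

theorem hasDerivAt_besselTerm (a : ℝ) (m : ℕ) (s : ℝ) :
    HasDerivAt (besselTerm a m) (besselTermDeriv a m s) s := by
  have h : HasDerivAt (fun s : ℝ => -s / 4) (-1 / 4) s := (hasDerivAt_id s).neg.div_const 4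
  exact (h.pow m).div_const _

theorem besselTermDeriv_zero (a s : ℝ) : besselTermDeriv a 0 s = 0 := by
  simp [besselTermDeriv]

theorem besselTermDeriv_succ {a : ℝ} (ha : 1 ≤ a) (m : ℕ) (s : ℝ) :
    besselTermDeriv a (m + 1) s = -(1 / (4 * a)) * besselTerm (a + 1) m s := by
  have h := (poch_pos (a := a + 1) (by linarith) m).ne'
  have hf : (m ! : ℝ) ≠ 0 := by positivity
  have ha' : a ≠ 0 := by linarith
  rw [besselTermDeriv, besselTerm, poch_succ_left, Nat.factorial_succ]
  push_cast
  have : (m : ℝ) + 1 ≠ 0 := by positivity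
  field_simp

theorem hasDerivAt_besselB {a : ℝ} (ha : 1 ≤ a) (s : ℝ) :
    HasDerivAt (besselB a) (-(1 / (4 * a)) * besselB (a + 1) s) s := by
  have ha1 : 1 ≤ a + 1 := by linarith
  set R := |s| + 1
  have hs : s ∈ Metric.ball (0 : ℝ) R := by simp [R]
  -- The differentiated series is, up to a constant and an index shift, the series with parameter `a
  -- + 1`, hence the shifted exponential majorant.
  let u : ℕ → ℝ := fun m => if m = 0 then 0 else R ^ (m - 1) / (m - 1)!
  have hu : Summable u := by
    rw [← summable_nat_add_iff 1]
    simpa [u] using Real.summable_pow_div_factorial R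
  have hbound : ∀ m y, y ∈ Metric.ball (0 : ℝ) R → ‖besselTermDeriv a m y‖ ≤ u m := by
    intro m y hy
    cases m with
    | zero => simp [u, besselTermDeriv_zero]
    | succ k =>
      have hy' : |y| ≤ R := by simpa using (mem_ball_zero_iff.1 hy).le
      rw [besselTermDeriv_succ ha, norm_mul, Real.norm_eq_abs, Real.norm_eq_abs, abs_neg]
      have h1 : |1 / (4 * a)| ≤ 1 := by
        rw [abs_of_pos (by positivity), div_le_one (by positivity)]; linarith
      have h2 : |besselTerm (a + 1) k y| ≤ R ^ k / k ! :=
        (abs_besselTerm_le ha1 k y).trans (by gcongr)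
      simp only [u, Nat.add_sub_cancel, if_neg (Nat.succ_ne_zero k)]
      calc _ ≤ 1 * (R ^ k / k !) := by gcongr
        _ = _ := one_mul _
  have h := hasDerivAt_tsum_of_isPreconnected hu Metric.isOpen_ball
    (convex_ball (0 : ℝ) R).isPreconnected (fun m y _ => hasDerivAt_besselTerm a m y) hbound
    hs (summable_besselTerm ha s) hs
  have hsum : HasSum (fun m => besselTermDeriv a m s) (-(1 / (4 * a)) * besselB (a + 1) s) := by
    rw [← hasSum_nat_add_iff' 1]
    simpa [besselTermDeriv_zero, besselTermDeriv_succ ha] using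
      (hasSum_besselB ha1 s).mul_left (-(1 / (4 * a)))
  rw [hsum.tsum_eq] at h
  exact h

theorem continuous_besselB {a : ℝ} (ha : 1 ≤ a) : Continuous (besselB a) :=
  continuous_iff_continuousAt.2 fun s => (hasDerivAt_besselB ha s).continuousAt

/-- Since raising `a` by one is differentiation up to a constant factor, this contiguous relation is
the second-order Bessel equation in disguise; it is proved by comparing coefficients. -/
theorem besselB_contiguous {a : ℝ} (ha : 1 ≤ a) (s : ℝ) :
    besselB (a + 1) s - besselB a s = s / (4 * a * (a + 1)) * besselB (a + 2) s := by
  have h1 := (hasSum_besselB (a := a + 1) (by linarith) s).sub (hasSum_besselB ha s)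
  have h2 := (hasSum_besselB (a := a + 2) (by linarith) s).mul_left (s / (4 * a * (a + 1)))
  rw [← hasSum_nat_add_iff' 1] at h1
  simp only [Finset.sum_range_one] at h1
  have h0 : besselTerm (a + 1) 0 s - besselTerm a 0 s = 0 := by simp [besselTerm, poch_zero]
  rw [h0, sub_zero] at h1
  refine h1.unique (h2.congr_fun ?_) |>.trans rfl
  intro m
  have hp := (poch_pos (a := a + 2) (by linarith) m).ne'
  have hf : (m ! : ℝ) ≠ 0 := by positivity
  have ha' : a ≠ 0 := by linarith
  have ha'' : a + 1 ≠ 0 := by linarith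
  have hm : (m : ℝ) + 1 ≠ 0 := by positivity
  have ham : a + 1 + m ≠ 0 := by positivity
  have e0 : poch (a + 1) (m + 1) = (a + 1) * poch (a + 2) m := by
    rw [poch_succ_left]; ring_nf
  have e1 : poch a (m + 1) * (a + 1 + m) = a * ((a + 1) * poch (a + 2) m) := by
    rw [poch_succ_left, mul_assoc, ← poch_succ, e0]
  have e2 : poch a (m + 1) = a * ((a + 1) * poch (a + 2) m) / (a + 1 + m) := by
    rw [← e1]; field_simp
  simp only [besselTerm, e0, e2, Nat.factorial_succ]
  push_cast
  field_simp
  ring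

/-! ### Gegenbauer polynomials and their differential equation -/

/-- The coefficients of `₂F₁(-n, n + 2 a - 1; a; z)`. -/
noncomputable def gegCoeff (a : ℝ) (n k : ℕ) : ℝ :=
  (-1) ^ k * n.descFactorial k * poch (n + 2 * a - 1) k / (k ! * poch a k)

/-- The Gegenbauer polynomial in the variable `z = (1 - t) / 2`. -/
noncomputable def gegPoly (a : ℝ) (n : ℕ) : Polynomial ℝ :=
  ∑ k ∈ Finset.range (n + 1), Polynomial.monomial k (gegCoeff a n k)

theorem gegCoeff_zero (a : ℝ) (n : ℕ) : gegCoeff a n 0 = 1 := by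
  simp [gegCoeff, poch_zero]

theorem coeff_gegPoly (a : ℝ) (n k : ℕ) : (gegPoly a n).coeff k = gegCoeff a n k := by
  simp only [gegPoly, Polynomial.finsetSum_coeff, Polynomial.coeff_monomial]
  rw [Finset.sum_ite_eq']
  split_ifs with h
  · rfl
  · have : n < k := by simpa using h
    simp [gegCoeff, Nat.descFactorial_of_lt this]

theorem gegPoly_eval_zero (a : ℝ) (n : ℕ) : (gegPoly a n).eval 0 = 1 := by
  rw [← Polynomial.coeff_zero_eq_eval_zero, coeff_gegPoly, gegCoeff_zero]

/-- The falling factorial vanishes beyond degree `n`, so the recurrence holds for every `k`, and the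
differential equation can be read off coefficient by coefficient. -/
theorem gegCoeff_succ {a : ℝ} (ha : 1 ≤ a) (n k : ℕ) :
    gegCoeff a n (k + 1) * ((k + 1) * (k + a)) =
      -((n - k) * (n + 2 * a - 1 + k)) * gegCoeff a n k := by
  have h1 := (poch_pos ha k).ne'
  have hf : (k ! : ℝ) ≠ 0 := by positivity
  have hk : (k : ℝ) + 1 ≠ 0 := by positivity
  have hak : a + k ≠ 0 := by positivity
  have hd : ((n.descFactorial (k + 1) : ℕ) : ℝ) = (n - k) * n.descFactorial k := by
    rw [Nat.descFactorial_succ]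
    push_cast
    rcases le_or_gt k n with h | h
    · rw [Nat.cast_sub h]
    · simp [Nat.descFactorial_of_lt h]
  rw [gegCoeff, gegCoeff, hd, poch_succ, poch_succ, Nat.factorial_succ]
  push_cast
  field_simp
  ring

open Polynomial in
theorem gegPoly_ode {a : ℝ} (ha : 1 ≤ a) (n : ℕ) :
    X * derivative (derivative (gegPoly a n)) - X ^ 2 * derivative (derivative (gegPoly a n)) +
      C a * derivative (gegPoly a n) - C (2 * a) * (X * derivative (gegPoly a n)) +
      C (n * (n + 2 * a - 1)) * gegPoly a n = 0 := by
  ext k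
  have h := gegCoeff_succ ha n k
  simp only [coeff_add, coeff_sub, coeff_C_mul, coeff_zero]
  rcases k with _ | _ | k
  · simp [coeff_derivative, coeff_gegPoly] at h ⊢
    simp [mul_assoc]
    linarith
  · simp [coeff_derivative, coeff_gegPoly, pow_two, mul_assoc, coeff_X_mul] at h ⊢
    linarith
  · simp [coeff_derivative, coeff_gegPoly, pow_two, mul_assoc, coeff_X_mul] at h ⊢
    linear_combination h

theorem gegPoly_ode_eval {a : ℝ} (ha : 1 ≤ a) (n : ℕ) (z : ℝ) :
    z * (1 - z) * (gegPoly a n).derivative.derivative.eval z +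
      (a - 2 * a * z) * (gegPoly a n).derivative.eval z +
      n * (n + 2 * a - 1) * (gegPoly a n).eval z = 0 := by
  have h := congrArg (Polynomial.eval z) (gegPoly_ode ha n)
  simp only [Polynomial.eval_add, Polynomial.eval_sub, Polynomial.eval_mul, Polynomial.eval_C,
    Polynomial.eval_X, Polynomial.eval_pow, Polynomial.eval_zero] at h
  linear_combination h

theorem gegenbauerG_eq_eval {d : ℕ} (hd : 3 ≤ d) (n : ℕ) (t : ℝ) :
    gegenbauerG n d t = (gegPoly (d / 2) n).eval ((1 - t) / 2) := by
  have hd' : (3 : ℝ) ≤ d := by exact_mod_cast hd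
  set a : ℝ := d / 2 with hadef
  have ha : 1 ≤ a := by rw [hadef]; linarith
  have hpn := (poch_pos ha n).ne'
  have hn : (n ! : ℝ) ≠ 0 := by positivity
  have hone : jacobiP (a - 1) (a - 1) n 1 = poch a n / n ! := by
    rw [jacobiP_one, poch]; ring_nf
  rw [gegenbauerG, ← hadef, hone, jacobiP, gegPoly, Polynomial.eval_finsetSum, Finset.sum_div]
  refine Finset.sum_congr rfl fun k hk => ?_
  have hk' : k ≤ n := Nat.lt_succ_iff.1 (Finset.mem_range.1 hk)
  have hpk := (poch_pos ha k).ne'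
  have hmul : poch a k * (ascPochhammer ℝ (n - k)).eval (a - 1 + k + 1) = poch a n := by
    have h := congrArg (Polynomial.eval a) (ascPochhammer_mul ℝ k (n - k))
    rw [Polynomial.eval_mul, Polynomial.eval_comp, Nat.add_sub_cancel' hk'] at h
    simp only [Polynomial.eval_add, Polynomial.eval_X, Polynomial.eval_natCast] at h
    rw [poch, poch, ← h]
    ring_nf
  have hdf : ((n - k)! : ℝ) * n.descFactorial k = n ! := by
    exact_mod_cast Nat.factorial_mul_descFactorial hk'
  have hnk : ((n - k)! : ℝ) ≠ 0 := by positivity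
  have hkf : (k ! : ℝ) ≠ 0 := by positivity
  have hpow : ((t - 1) / 2) ^ k = (-1) ^ k * ((1 - t) / 2) ^ k := by
    rw [← mul_pow]; ring_nf
  rw [Polynomial.eval_monomial, gegCoeff, hpow, ← hmul, ← hdf]
  have e : (n : ℝ) + (a - 1) + (a - 1) + 1 = n + 2 * a - 1 := by ring
  rw [e, ← poch]
  have hasc : (ascPochhammer ℝ (n - k)).eval (a - 1 + k + 1) ≠ 0 := by
    intro h0; rw [h0, mul_zero] at hmul; exact hpn hmul.symm
  have hdf0 : (n.descFactorial k : ℝ) ≠ 0 := by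
    intro h0; rw [h0, mul_zero] at hdf; exact hn hdf.symm
  field_simp

/-- `θ ↦ G(cos θ)`. -/
noncomputable def gegAngle (a : ℝ) (n : ℕ) (θ : ℝ) : ℝ :=
  (gegPoly a n).eval ((1 - Real.cos θ) / 2)

/-- The derivative of `gegAngle`. -/
noncomputable def gegAngleDeriv (a : ℝ) (n : ℕ) (θ : ℝ) : ℝ :=
  (gegPoly a n).derivative.eval ((1 - Real.cos θ) / 2) * (Real.sin θ / 2)

/-- The second derivative of `gegAngle`. -/
noncomputable def gegAngleDeriv2 (a : ℝ) (n : ℕ) (θ : ℝ) : ℝ :=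
  (gegPoly a n).derivative.derivative.eval ((1 - Real.cos θ) / 2) * (Real.sin θ / 2) *
      (Real.sin θ / 2) +
    (gegPoly a n).derivative.eval ((1 - Real.cos θ) / 2) * (Real.cos θ / 2)

theorem hasDerivAt_half_one_sub_cos (θ : ℝ) :
    HasDerivAt (fun θ : ℝ => (1 - Real.cos θ) / 2) (Real.sin θ / 2) θ := by
  simpa using ((Real.hasDerivAt_cos θ).const_sub 1).div_const 2

theorem hasDerivAt_gegAngle (a : ℝ) (n : ℕ) (θ : ℝ) :
    HasDerivAt (gegAngle a n) (gegAngleDeriv a n θ) θ :=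
  ((gegPoly a n).hasDerivAt _).comp θ (hasDerivAt_half_one_sub_cos θ)

theorem hasDerivAt_gegAngleDeriv (a : ℝ) (n : ℕ) (θ : ℝ) :
    HasDerivAt (gegAngleDeriv a n) (gegAngleDeriv2 a n θ) θ :=
  (((gegPoly a n).derivative.hasDerivAt _).comp θ (hasDerivAt_half_one_sub_cos θ)).mul
    ((Real.hasDerivAt_sin θ).div_const 2)

theorem continuous_gegAngle (a : ℝ) (n : ℕ) : Continuous (gegAngle a n) :=
  continuous_iff_continuousAt.2 fun θ => (hasDerivAt_gegAngle a n θ).continuousAt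

theorem gegAngle_zero (a : ℝ) (n : ℕ) : gegAngle a n 0 = 1 := by
  simp [gegAngle, gegPoly_eval_zero]

theorem gegAngleDeriv_zero (a : ℝ) (n : ℕ) : gegAngleDeriv a n 0 = 0 := by
  simp [gegAngleDeriv]

/-- Keeping the factor `sin θ` instead of a cotangent makes the equation valid also at the singular
point `θ = 0`. -/
theorem gegAngle_ode {a : ℝ} (ha : 1 ≤ a) (n : ℕ) (θ : ℝ) :
    Real.sin θ * gegAngleDeriv2 a n θ = -((2 * a - 1) * Real.cos θ * gegAngleDeriv a n θ) -
      n * (n + 2 * a - 1) * Real.sin θ * gegAngle a n θ := by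
  have h := gegPoly_ode_eval ha n ((1 - Real.cos θ) / 2)
  have hs := Real.sin_sq_add_cos_sq θ
  simp only [gegAngleDeriv2, gegAngleDeriv, gegAngle]
  linear_combination Real.sin θ * h + (Real.sin θ / 4 *
    (gegPoly a n).derivative.derivative.eval ((1 - Real.cos θ) / 2)) * hs

/-! ### Uniform bounds: energy and the Sonin function -/

/-- The first-order term of the equation acts as friction: the energy has derivative `-2 (2a - 1)
cot θ · G'² ≤ 0` on `(0, π/2)`, and the right side is its value at `0`. -/
theorem gegAngle_energy_le {a : ℝ} (ha : 1 ≤ a) (n : ℕ) {θ : ℝ} (h0 : 0 ≤ θ)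
    (h1 : θ ≤ Real.pi / 2) :
    gegAngleDeriv a n θ ^ 2 + n * (n + 2 * a - 1) * gegAngle a n θ ^ 2 ≤
      n * (n + 2 * a - 1) := by
  have hd : ∀ x, HasDerivAt
      (fun θ => gegAngleDeriv a n θ ^ 2 + n * (n + 2 * a - 1) * gegAngle a n θ ^ 2)
      (2 * gegAngleDeriv a n x * gegAngleDeriv2 a n x +
        n * (n + 2 * a - 1) * (2 * gegAngle a n x * gegAngleDeriv a n x)) x := by
    intro x
    exact (((hasDerivAt_gegAngleDeriv a n x).pow 2).add
      (((hasDerivAt_gegAngle a n x).pow 2).const_mul (n * (n + 2 * a - 1)))).congr_deriv (by simp)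
  have hanti : AntitoneOn
      (fun θ => gegAngleDeriv a n θ ^ 2 + n * (n + 2 * a - 1) * gegAngle a n θ ^ 2)
      (Icc 0 (Real.pi / 2)) := by
    apply antitoneOn_of_deriv_nonpos (convex_Icc _ _)
    · exact fun x _ => (hd x).continuousAt.continuousWithinAt
    · exact fun x _ => (hd x).differentiableAt.differentiableWithinAt
    · intro x hx
      rw [interior_Icc] at hx
      rw [(hd x).deriv]
      have hs : 0 < Real.sin x := Real.sin_pos_of_pos_of_lt_pi hx.1 (by linarith [hx.2, Real.pi_pos])
      have hc : 0 ≤ Real.cos x := Real.cos_nonneg_of_mem_Icc ⟨by linarith [hx.1, Real.pi_pos], hx.2.le⟩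
      have hode := gegAngle_ode ha n x
      by_contra! hpos
      have h2 := mul_pos hs hpos
      have h3 : 0 ≤ (2 * a - 1) * Real.cos x * gegAngleDeriv a n x ^ 2 := by
        have : 0 ≤ 2 * a - 1 := by linarith
        positivity
      have h4 : Real.sin x * (2 * gegAngleDeriv a n x * gegAngleDeriv2 a n x +
          n * (n + 2 * a - 1) * (2 * gegAngle a n x * gegAngleDeriv a n x)) =
          -2 * ((2 * a - 1) * Real.cos x * gegAngleDeriv a n x ^ 2) := by
        linear_combination 2 * gegAngleDeriv a n x * hode
      linarith
  have h := hanti (left_mem_Icc.2 (h0.trans h1)) ⟨h0, h1⟩ h0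
  simpa [gegAngle_zero, gegAngleDeriv_zero] using h

theorem abs_gegAngle_le_one {a : ℝ} (ha : 1 ≤ a) {n : ℕ} (hn : 1 ≤ n) {θ : ℝ} (h0 : 0 ≤ θ)
    (h1 : θ ≤ Real.pi / 2) : |gegAngle a n θ| ≤ 1 := by
  have h := gegAngle_energy_le ha n h0 h1
  have hn' : (1 : ℝ) ≤ n := by exact_mod_cast hn
  have hK : 0 < (n : ℝ) * (n + 2 * a - 1) := by
    apply mul_pos <;> linarith
  rw [← sq_le_one_iff_abs_le_one]
  nlinarith [sq_nonneg (gegAngleDeriv a n θ)]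

/-- The logarithmic-derivative combination `λ cot θ · G + G'`, where `λ = a - 1/2`. -/
noncomputable def soninE (a : ℝ) (n : ℕ) (θ : ℝ) : ℝ :=
  (a - 1 / 2) * (Real.cos θ / Real.sin θ) * gegAngle a n θ + gegAngleDeriv a n θ

/-- The potential of the Liouville normal form of the Gegenbauer equation. -/
noncomputable def soninPhi (a : ℝ) (n : ℕ) (θ : ℝ) : ℝ :=
  (n + (a - 1 / 2)) ^ 2 - (a - 1 / 2) * (a - 3 / 2) / Real.sin θ ^ 2

/-- The Sonin function of `(sin θ)^λ G(cos θ)`, where `k = 2 λ`. -/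
noncomputable def soninF (a : ℝ) (k n : ℕ) (θ : ℝ) : ℝ :=
  Real.sin θ ^ k * (gegAngle a n θ ^ 2 + soninE a n θ ^ 2 / soninPhi a n θ)

theorem hasDerivAt_soninE {a : ℝ} (ha : 1 ≤ a) (n : ℕ) {θ : ℝ} (hs : Real.sin θ ≠ 0) :
    HasDerivAt (soninE a n) (-((a - 1 / 2) * (Real.cos θ / Real.sin θ) * soninE a n θ) -
      soninPhi a n θ * gegAngle a n θ) θ := by
  have h1 := (Real.hasDerivAt_cos θ).div (Real.hasDerivAt_sin θ) hs
  have h := ((h1.const_mul (a - 1 / 2)).mul (hasDerivAt_gegAngle a n θ)).add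
    (hasDerivAt_gegAngleDeriv a n θ)
  refine h.congr_deriv ?_
  have hode := gegAngle_ode ha n θ
  have hsc := Real.sin_sq_add_cos_sq θ
  have h2 : gegAngleDeriv2 a n θ = (-((2 * a - 1) * Real.cos θ * gegAngleDeriv a n θ) -
      n * (n + 2 * a - 1) * Real.sin θ * gegAngle a n θ) / Real.sin θ := by
    rw [← hode]; field_simp
  rw [h2, soninE, soninPhi]
  simp only [Pi.div_apply]
  have hc2 : Real.cos θ ^ 2 = 1 - Real.sin θ ^ 2 := by linarith
  field_simp
  ring_nf
  rw [hc2]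
  ring

theorem hasDerivAt_soninPhi (a : ℝ) (n : ℕ) {θ : ℝ} (hs : Real.sin θ ≠ 0) :
    HasDerivAt (soninPhi a n)
      (2 * ((a - 1 / 2) * (a - 3 / 2)) * Real.cos θ / Real.sin θ ^ 3) θ := by
  have h := (((hasDerivAt_const θ ((a - 1 / 2) * (a - 3 / 2))).div
    ((Real.hasDerivAt_sin θ).pow 2) (pow_ne_zero 2 hs)).const_sub ((n + (a - 1 / 2)) ^ 2))
  refine h.congr_deriv ?_
  simp only [Pi.pow_apply]
  field_simp
  ring

/-- With `λ = a - 1/2`, the function `u = (sin θ)^λ G` satisfies `u'' + φ u = 0` and `u' = (sin θ)^λ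
E`. Hence the Sonin function `u² + u'²/φ` has derivative `-u'² φ'/φ²`. Squaring leaves the integer
power `k = 2λ` of the sine. -/
theorem hasDerivAt_soninF {a : ℝ} (ha : 1 ≤ a) {k : ℕ} (hk : (k : ℝ) = 2 * a - 1) (n : ℕ) {θ : ℝ}
    (hs : Real.sin θ ≠ 0) (hφ : soninPhi a n θ ≠ 0) :
    HasDerivAt (soninF a k n) (-(Real.sin θ ^ k * soninE a n θ ^ 2 *
      (2 * ((a - 1 / 2) * (a - 3 / 2)) * Real.cos θ / Real.sin θ ^ 3) /
        soninPhi a n θ ^ 2)) θ := by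
  have h := ((Real.hasDerivAt_sin θ).pow k).mul (((hasDerivAt_gegAngle a n θ).pow 2).add
    (((hasDerivAt_soninE ha n hs).pow 2).div (hasDerivAt_soninPhi a n hs) hφ))
  refine h.congr_deriv ?_
  have hk0 : k ≠ 0 := by
    rintro rfl
    norm_num at hk
    linarith
  obtain ⟨j, rfl⟩ := Nat.exists_eq_succ_of_ne_zero hk0
  have hG : gegAngleDeriv a n θ = soninE a n θ -
      (a - 1 / 2) * (Real.cos θ / Real.sin θ) * gegAngle a n θ := by
    rw [soninE]; ring
  rw [hG, hk]
  simp only [Pi.pow_apply, Pi.add_apply, Pi.div_apply, Nat.succ_eq_add_one, Nat.add_sub_cancel,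
    Nat.cast_ofNat, pow_succ (Real.sin θ) j]
  generalize soninE a n θ = E at *
  generalize soninPhi a n θ = p at *
  generalize gegAngle a n θ = G at *
  generalize Real.sin θ ^ j = S
  field_simp
  ring

/-- Jordan's inequality `sin θ ≥ 2θ/π` gives `sin θ ≥ 2λ/N` with `λ = a - 1/2`, `N = n + λ`, so the
singular term of the potential is at most `N²/4` from this threshold on. -/
theorem three_quarters_le_soninPhi {a : ℝ} (ha : 3 / 2 ≤ a) {n : ℕ} {θ : ℝ}
    (h0 : Real.pi * (a - 1 / 2) / (n + (a - 1 / 2)) ≤ θ) (h1 : θ ≤ Real.pi / 2) :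
    3 / 4 * (n + (a - 1 / 2)) ^ 2 ≤ soninPhi a n θ := by
  have hN : 0 < (n : ℝ) + (a - 1 / 2) := by
    have : (0 : ℝ) ≤ n := n.cast_nonneg
    linarith
  have hpi := Real.pi_pos
  have hl : 0 < a - 1 / 2 := by linarith
  have hθ : 0 < θ := lt_of_lt_of_le (by positivity) h0
  have hs := Real.mul_le_sin hθ.le h1
  have hs0 : 0 < 2 / Real.pi * θ := by positivity
  have hsin : 0 < Real.sin θ := hs0.trans_le hs
  have h2 : 2 * (a - 1 / 2) ≤ Real.sin θ * (n + (a - 1 / 2)) := by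
    rw [div_le_iff₀ hN] at h0
    calc 2 * (a - 1 / 2) = 2 / Real.pi * (Real.pi * (a - 1 / 2)) := by field_simp
      _ ≤ 2 / Real.pi * (θ * (n + (a - 1 / 2))) := by gcongr
      _ = 2 / Real.pi * θ * (n + (a - 1 / 2)) := by ring
      _ ≤ _ := by gcongr
  have h3 : (a - 1 / 2) * (a - 3 / 2) / Real.sin θ ^ 2 ≤ 1 / 4 * (n + (a - 1 / 2)) ^ 2 := by
    rw [div_le_iff₀ (by positivity)]
    nlinarith
  rw [soninPhi]
  linarith

theorem soninF_antitoneOn {a : ℝ} (ha : 3 / 2 ≤ a) {k : ℕ} (hk : (k : ℝ) = 2 * a - 1) (n : ℕ) :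
    AntitoneOn (soninF a k n)
      (Icc (Real.pi * (a - 1 / 2) / (n + (a - 1 / 2))) (Real.pi / 2)) := by
  have hN : 0 < (n : ℝ) + (a - 1 / 2) := by
    have : (0 : ℝ) ≤ n := n.cast_nonneg
    linarith
  have hl : 0 < a - 1 / 2 := by linarith
  have hpi := Real.pi_pos
  have hθ0 : 0 < Real.pi * (a - 1 / 2) / (n + (a - 1 / 2)) := by positivity
  have hd : ∀ x ∈ Icc (Real.pi * (a - 1 / 2) / (n + (a - 1 / 2))) (Real.pi / 2),
      0 < Real.sin x ∧ HasDerivAt (soninF a k n) (-(Real.sin x ^ k * soninE a n x ^ 2 *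
        (2 * ((a - 1 / 2) * (a - 3 / 2)) * Real.cos x / Real.sin x ^ 3) /
          soninPhi a n x ^ 2)) x := by
    intro x hx
    have hs : 0 < Real.sin x := Real.sin_pos_of_pos_of_lt_pi (hθ0.trans_le hx.1) (by linarith [hx.2])
    have hφ := three_quarters_le_soninPhi ha hx.1 hx.2
    exact ⟨hs, hasDerivAt_soninF (by linarith) hk n hs.ne' (by nlinarith [sq_pos_of_pos hN])⟩
  apply antitoneOn_of_deriv_nonpos (convex_Icc _ _)
  · exact fun x hx => (hd x hx).2.continuousAt.continuousWithinAt
  · exact fun x hx => (hd x (interior_subset hx)).2.differentiableAt.differentiableWithinAt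
  · intro x hx
    have hx' := interior_subset hx
    obtain ⟨hs, h⟩ := hd x hx'
    have hc : 0 ≤ Real.cos x := Real.cos_nonneg_of_mem_Icc ⟨by linarith [hx'.1], hx'.2⟩
    rw [h.deriv, neg_nonpos]
    have : 0 ≤ a - 3 / 2 := by linarith
    positivity

/-- The energy bound controls the initial data: `|G| ≤ 1`, `|G'| ≤ N` and `λ cot θ ≤ N/2`, so `E²/φ
≤ (9/4)/(3/4) = 3`, and the constant is `1 + 3`. -/
theorem soninF_start_le {a : ℝ} (ha : 3 / 2 ≤ a) {k n : ℕ} (hn : 1 ≤ n)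
    {θ : ℝ} (h0 : θ = Real.pi * (a - 1 / 2) / (n + (a - 1 / 2))) (h1 : θ ≤ Real.pi / 2) :
    soninF a k n θ ≤ 4 * θ ^ k := by
  have hn' : (1 : ℝ) ≤ n := by exact_mod_cast hn
  set N : ℝ := n + (a - 1 / 2) with hNdef
  have hN : 0 < N := by linarith
  have hl : 0 < a - 1 / 2 := by linarith
  have hpi := Real.pi_pos
  have hθ : 0 < θ := by rw [h0]; positivity
  have hs : 0 < Real.sin θ := Real.sin_pos_of_pos_of_lt_pi hθ (by linarith)
  have hφ : 3 / 4 * N ^ 2 ≤ soninPhi a n θ := three_quarters_le_soninPhi ha h0.ge h1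
  have hG := abs_gegAngle_le_one (by linarith : 1 ≤ a) hn hθ.le h1
  have hG' : |gegAngleDeriv a n θ| ≤ N := by
    have h := gegAngle_energy_le (by linarith : 1 ≤ a) n hθ.le h1
    refine abs_le_of_sq_le_sq ?_ hN.le
    have : 0 ≤ (n : ℝ) * (n + 2 * a - 1) * gegAngle a n θ ^ 2 := by
      have : 0 ≤ (n : ℝ) + 2 * a - 1 := by linarith
      positivity
    rw [hNdef]
    nlinarith
  have hcot : |(a - 1 / 2) * (Real.cos θ / Real.sin θ)| ≤ N / 2 := by
    have hc : |Real.cos θ| ≤ 1 := Real.abs_cos_le_one θ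
    have hsin := Real.mul_le_sin hθ.le h1
    rw [abs_mul, abs_div, abs_of_pos hl, abs_of_pos hs]
    have e : 2 / Real.pi * θ = 2 * (a - 1 / 2) / N := by rw [h0]; field_simp
    rw [e, div_le_iff₀ hN] at hsin
    rw [mul_div_assoc', div_le_iff₀ hs]
    nlinarith
  have hE : |soninE a n θ| ≤ 3 / 2 * N := by
    calc |soninE a n θ| ≤ |(a - 1 / 2) * (Real.cos θ / Real.sin θ) * gegAngle a n θ| +
          |gegAngleDeriv a n θ| := abs_add_le _ _
      _ ≤ N / 2 * 1 + N := by
        rw [abs_mul]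
        gcongr
      _ = _ := by ring
  have hE2 : soninE a n θ ^ 2 ≤ 9 / 4 * N ^ 2 := by
    rw [← sq_abs]
    nlinarith [abs_nonneg (soninE a n θ)]
  have hq : soninE a n θ ^ 2 / soninPhi a n θ ≤ 3 := by
    rw [div_le_iff₀ (by nlinarith [sq_pos_of_pos hN])]
    linarith
  have hG2 : gegAngle a n θ ^ 2 ≤ 1 := (sq_le_one_iff_abs_le_one _).2 hG
  have hsk : Real.sin θ ^ k ≤ θ ^ k := pow_le_pow_left₀ hs.le (Real.sin_le hθ.le) k
  rw [soninF]
  calc _ ≤ Real.sin θ ^ k * 4 := by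
        gcongr; linarith
    _ ≤ θ ^ k * 4 := by gcongr
    _ = _ := by ring

/-- Up to the threshold `θ₀` of order `1/n` the bound `|G| ≤ 1` suffices; beyond it the Sonin
function is at most its value at `θ₀`, and Jordan's inequality trades `sin θ` for `θ`. -/
theorem gegAngle_sq_mul_le {a : ℝ} (ha : 3 / 2 ≤ a) {k : ℕ} (hk : (k : ℝ) = 2 * a - 1) {n : ℕ}
    (hn : 1 ≤ n) {θ : ℝ} (h0 : 0 ≤ θ) (h1 : θ ≤ Real.pi / 2) :
    gegAngle a n θ ^ 2 * (n * θ) ^ k ≤ 4 * (2 * Real.pi * a) ^ k := by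
  have hn' : (1 : ℝ) ≤ n := by exact_mod_cast hn
  set N : ℝ := n + (a - 1 / 2) with hNdef
  have hN : 0 < N := by linarith
  have hnN : n ≤ N := by linarith
  have hl : 0 < a - 1 / 2 := by linarith
  have hpi := Real.pi_pos
  set θ₀ := Real.pi * (a - 1 / 2) / N with hθ₀def
  have hθ₀ : 0 < θ₀ := by positivity
  have hnθ₀ : n * θ₀ ≤ Real.pi * a := by
    calc n * θ₀ ≤ N * θ₀ := by gcongr
      _ = Real.pi * (a - 1 / 2) := by rw [hθ₀def]; field_simp
      _ ≤ _ := by nlinarith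
  rcases le_or_gt θ θ₀ with h | h
  · have hG2 : gegAngle a n θ ^ 2 ≤ 1 :=
      (sq_le_one_iff_abs_le_one _).2 (abs_gegAngle_le_one (by linarith) hn h0 h1)
    have h2 : n * θ ≤ 2 * Real.pi * a := by
      have : n * θ ≤ n * θ₀ := by gcongr
      nlinarith
    gcongr
    linarith
  · have hs := Real.mul_le_sin h0 h1
    have hanti := soninF_antitoneOn ha hk n ⟨le_rfl, h.le.trans h1⟩ ⟨h.le, h1⟩ h.le
    have hstart := soninF_start_le (k := k) ha hn hθ₀def (h.le.trans h1)
    have hφ : 3 / 4 * N ^ 2 ≤ soninPhi a n θ := three_quarters_le_soninPhi ha h.le h1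
    have hφ0 : 0 < soninPhi a n θ := by nlinarith [sq_pos_of_pos hN]
    have hθ : 0 < θ := hθ₀.trans h
    have hsin : 0 < Real.sin θ := lt_of_lt_of_le (by positivity) hs
    have hlow : (2 / Real.pi * θ) ^ k * gegAngle a n θ ^ 2 ≤ soninF a k n θ := by
      rw [soninF]
      gcongr
      have : 0 ≤ soninE a n θ ^ 2 / soninPhi a n θ := by positivity
      linarith
    have hmain : (2 / Real.pi * θ) ^ k * gegAngle a n θ ^ 2 ≤ 4 * θ₀ ^ k :=
      hlow.trans (hanti.trans hstart)
    have e : n * θ = (Real.pi / 2 * n) * (2 / Real.pi * θ) := by field_simp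
    calc gegAngle a n θ ^ 2 * (n * θ) ^ k
        = (Real.pi / 2 * n) ^ k * ((2 / Real.pi * θ) ^ k * gegAngle a n θ ^ 2) := by
          rw [e, mul_pow]; ring
      _ ≤ (Real.pi / 2 * n) ^ k * (4 * θ₀ ^ k) := by gcongr
      _ = 4 * (Real.pi / 2 * (n * θ₀)) ^ k := by rw [mul_pow, mul_pow, mul_pow]; ring
      _ ≤ 4 * (2 * Real.pi * a) ^ k := by
        have h2 : Real.pi / 2 * (n * θ₀) ≤ 2 * Real.pi * a := by
          have : n * θ₀ ≤ 4 * a :=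
            hnθ₀.trans (mul_le_mul_of_nonneg_right Real.pi_le_four (by linarith))
          nlinarith
        exact mul_le_mul_of_nonneg_left (pow_le_pow_left₀ (by positivity) h2 k) (by norm_num)

/-! ### The Mehler–Heine limit -/

theorem gegPoly_eval_eq_tsum (a : ℝ) (n : ℕ) (z : ℝ) :
    (gegPoly a n).eval z = ∑' k, gegCoeff a n k * z ^ k := by
  rw [tsum_eq_sum (s := Finset.range (n + 1)), gegPoly, Polynomial.eval_finsetSum]
  · simp
  · intro k hk
    have : n < k := by simpa using hk
    simp [gegCoeff, Nat.descFactorial_of_lt this]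

theorem poch_le_pow {b : ℝ} (hb : 0 ≤ b) (k : ℕ) : poch b k ≤ (b + k) ^ k ∧ 0 ≤ poch b k := by
  induction k with
  | zero => simp [poch_zero]
  | succ k ih =>
    have hk : (0 : ℝ) ≤ k := k.cast_nonneg
    rw [poch_succ]
    push_cast
    refine ⟨?_, mul_nonneg ih.2 (by positivity)⟩
    calc poch b k * (b + k) ≤ (b + k) ^ k * (b + k) := by gcongr; exact ih.1
      _ = (b + k) ^ (k + 1) := (pow_succ _ _).symm
      _ ≤ _ := by gcongr; linarith

theorem tendsto_add_const_div_natCast (c : ℝ) :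
    Tendsto (fun n : ℕ => ((n : ℝ) + c) / n) atTop (𝓝 1) := by
  have h : Tendsto (fun n : ℕ => 1 + c / (n : ℝ)) atTop (𝓝 (1 + 0)) :=
    (tendsto_const_div_atTop_nhds_zero_nat c).const_add 1
  rw [add_zero] at h
  refine h.congr' ?_
  filter_upwards [eventually_gt_atTop 0] with n hn
  have : (n : ℝ) ≠ 0 := by positivity
  field_simp

theorem tendsto_poch_div_pow (b : ℝ) (k : ℕ) :
    Tendsto (fun n : ℕ => poch (n + b) k / (n : ℝ) ^ k) atTop (𝓝 1) := by
  induction k with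
  | zero => simp [poch_zero]
  | succ k ih =>
    have h := ih.mul (tendsto_add_const_div_natCast (b + k))
    rw [one_mul] at h
    refine h.congr fun n => ?_
    rw [poch_succ, pow_succ, div_mul_div_comm, add_assoc]

theorem tendsto_descFactorial_div_pow (k : ℕ) :
    Tendsto (fun n : ℕ => (n.descFactorial k : ℝ) / (n : ℝ) ^ k) atTop (𝓝 1) := by
  induction k with
  | zero => simp
  | succ k ih =>
    have h := ih.mul (tendsto_add_const_div_natCast (-k))
    rw [one_mul] at h
    refine h.congr' ?_
    filter_upwards [eventually_ge_atTop k] with n hn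
    rw [Nat.descFactorial_succ, pow_succ, div_mul_div_comm]
    push_cast [Nat.cast_sub hn]
    ring

theorem tendsto_sq_mul_half_one_sub_cos (ψ : ℝ) :
    Tendsto (fun n : ℕ => (n : ℝ) ^ 2 * ((1 - Real.cos (ψ / n)) / 2)) atTop (𝓝 (ψ ^ 2 / 4)) := by
  have h1 : Tendsto (fun n : ℕ => Real.sinc (ψ / n / 2)) atTop (𝓝 1) := by
    have : Tendsto (fun n : ℕ => ψ / (n : ℝ) / 2) atTop (𝓝 (0 / 2)) :=
      (tendsto_const_div_atTop_nhds_zero_nat ψ).div_const 2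
    rw [zero_div] at this
    simpa [Function.comp_def] using (Real.continuous_sinc.tendsto 0).comp this
  have h2 := (h1.pow 2).const_mul (ψ ^ 2 / 4)
  rw [one_pow, mul_one] at h2
  refine h2.congr' ?_
  filter_upwards [eventually_gt_atTop 0] with n hn
  have hn' : (n : ℝ) ≠ 0 := by positivity
  rcases eq_or_ne ψ 0 with rfl | hψ
  · simp
  · rw [Real.sinc_of_ne_zero (by positivity)]
    have e : (1 - Real.cos (ψ / n)) / 2 = Real.sin (ψ / n / 2) ^ 2 := by
      have := Real.cos_sq' (ψ / n / 2)
      have h3 := Real.cos_sq (ψ / n / 2)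
      rw [mul_div_cancel₀ _ (two_ne_zero)] at h3
      linarith
    rw [e]
    field_simp
    norm_num

/-- The Mehler–Heine formula. -/
theorem tendsto_gegAngle_div {a : ℝ} (ha : 1 ≤ a) (ψ : ℝ) :
    Tendsto (fun n : ℕ => gegAngle a n (ψ / n)) atTop (𝓝 (besselB a (ψ ^ 2))) := by
  simp only [gegAngle, gegPoly_eval_eq_tsum, besselB]
  -- The majorant comes from three bounds valid for `k ≤ n`: falling factorial at most `n^k`, rising
  -- factorial at most `(n(2a + 2))^k`, and `(1 - cos(ψ/n))/2 ≤ ψ²/(4n²)`. The powers of `n` cancel.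
  refine tendsto_tsum_of_dominated_convergence
    (bound := fun k : ℕ => ((2 * a + 2) * (ψ ^ 2 / 4)) ^ k / k !)
    (Real.summable_pow_div_factorial _) ?_ ?_
  · intro k
    have h := (((tendsto_descFactorial_div_pow k).mul (tendsto_poch_div_pow (2 * a - 1) k)).mul
      ((tendsto_sq_mul_half_one_sub_cos ψ).pow k)).mul_const ((-1) ^ k / (k ! * poch a k))
    have e : 1 * 1 * (ψ ^ 2 / 4) ^ k * ((-1) ^ k / (k ! * poch a k)) =
        besselTerm a k (ψ ^ 2) := by
      rw [besselTerm, show -ψ ^ 2 / 4 = (-1) * (ψ ^ 2 / 4) by ring, mul_pow (-1 : ℝ)]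
      ring
    rw [e] at h
    refine h.congr' ?_
    filter_upwards [eventually_gt_atTop 0] with n hn
    have hn' : (n : ℝ) ≠ 0 := by positivity
    rw [gegCoeff, mul_pow, add_sub_assoc]
    field_simp
    ring
  · filter_upwards [eventually_gt_atTop 0] with n hn k
    rcases le_or_gt k n with hkn | hkn
    · have hn' : (1 : ℝ) ≤ n := by exact_mod_cast hn
      have hkn' : (k : ℝ) ≤ n := by exact_mod_cast hkn
      have hp := poch_pos ha k
      have hp1 := one_le_poch ha k
      have hkf : (0 : ℝ) < k ! := by positivity
      obtain ⟨hq, hq0⟩ := poch_le_pow (b := n + 2 * a - 1) (by linarith) k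
      have hd : (n.descFactorial k : ℝ) ≤ (n : ℝ) ^ k := by
        exact_mod_cast Nat.descFactorial_le_pow n k
      have hq' : poch (n + 2 * a - 1) k ≤ (n * (2 * a + 2)) ^ k :=
        hq.trans (pow_le_pow_left₀ (by linarith [(Nat.cast_nonneg k : (0 : ℝ) ≤ k)]) (by nlinarith) k)
      have hz0 : 0 ≤ (1 - Real.cos (ψ / n)) / 2 := by linarith [Real.cos_le_one (ψ / n)]
      have hz : (1 - Real.cos (ψ / n)) / 2 ≤ ψ ^ 2 / 4 / n ^ 2 := by
        have h := Real.one_sub_sq_div_two_le_cos (x := ψ / n)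
        rw [div_pow] at h
        have e : ψ ^ 2 / 4 / (n : ℝ) ^ 2 = ψ ^ 2 / n ^ 2 / 4 := by ring
        rw [e]
        linarith
      rw [gegCoeff, norm_mul, norm_div, norm_mul, norm_mul, norm_pow, norm_neg, norm_one, one_pow,
        one_mul, Real.norm_of_nonneg (Nat.cast_nonneg _), Real.norm_of_nonneg hq0,
        Real.norm_of_nonneg (by positivity : 0 ≤ (k ! : ℝ) * poch a k), norm_pow,
        Real.norm_of_nonneg hz0]
      calc _ ≤ (n : ℝ) ^ k * (n * (2 * a + 2)) ^ k / (k ! * 1) * (ψ ^ 2 / 4 / n ^ 2) ^ k := by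
            gcongr
        _ = _ := by
            rw [mul_one, div_mul_eq_mul_div, ← mul_pow, ← mul_pow]
            congr 2
            field_simp
    · rw [gegCoeff, Nat.descFactorial_of_lt hkn]
      simp only [Nat.cast_zero, mul_zero, zero_mul, zero_div, norm_zero]
      positivity

theorem eventually_div_natCast_mem (ψ : ℝ) (hψ : 0 ≤ ψ) :
    ∀ᶠ n : ℕ in atTop, 1 ≤ n ∧ 0 ≤ ψ / n ∧ ψ / n ≤ Real.pi / 2 := by
  have h := (tendsto_const_div_atTop_nhds_zero_nat ψ).eventually
    (eventually_le_nhds (show (0 : ℝ) < Real.pi / 2 by positivity))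
  filter_upwards [h, eventually_ge_atTop 1] with n h1 h2
  exact ⟨h2, by positivity, h1⟩

/-- Bounds uniform in `n` pass to the Mehler–Heine limit; the decay bound `besselB_sq_mul_le` is
obtained in the same way. -/
theorem abs_besselB_le_one {a : ℝ} (ha : 1 ≤ a) {x : ℝ} (hx : 0 ≤ x) : |besselB a x| ≤ 1 := by
  have h := (tendsto_gegAngle_div ha (Real.sqrt x)).abs
  rw [Real.sq_sqrt hx] at h
  refine le_of_tendsto h ?_
  filter_upwards [eventually_div_natCast_mem _ (Real.sqrt_nonneg x)] with n hn
  exact abs_gegAngle_le_one ha hn.1 hn.2.1 hn.2.2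

theorem besselB_sq_mul_le {a : ℝ} (ha : 3 / 2 ≤ a) {k : ℕ} (hk : (k : ℝ) = 2 * a - 1) {x : ℝ}
    (hx : 0 ≤ x) : besselB a (x ^ 2) ^ 2 * x ^ k ≤ 4 * (2 * Real.pi * a) ^ k := by
  have h := ((tendsto_gegAngle_div (by linarith : 1 ≤ a) x).pow 2).mul_const (x ^ k)
  refine le_of_tendsto h ?_
  filter_upwards [eventually_div_natCast_mem _ hx] with n hn
  have hn' : (n : ℝ) ≠ 0 := by have := hn.1; positivity
  have := gegAngle_sq_mul_le ha hk hn.1 hn.2.1 hn.2.2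
  rwa [mul_div_cancel₀ _ hn'] at this

/-! ### Dominated convergence outside the exceptional case -/

/-- An integrable majorant for `|x|^q ψ^k` when `|x| ≤ 1` and `x^2 ψ^k ≤ M`. -/
noncomputable def decayBound (M : ℝ) (q k : ℕ) (ψ : ℝ) : ℝ :=
  if ψ ≤ 1 then 1 else M ^ ((q : ℝ) / 2) * ψ ^ ((k : ℝ) - k * q / 2)

theorem integrableOn_decayBound (M : ℝ) {q k : ℕ} (hq : 3 ≤ q) (hk : 2 ≤ k)
    (hqk : ¬(q = 3 ∧ k = 2)) : IntegrableOn (decayBound M q k) (Ioi 0) := by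
  have hexp : (k : ℝ) - k * q / 2 < -1 := by
    -- Integrability amounts to `k (q - 2) > 2`, which for `q ≥ 3`, `k ≥ 2` fails only at `q = 3`,
    -- `k = 2`.
    have h : 2 * k + 2 < k * q := by
      rcases Nat.lt_or_ge 3 q with h | h
      · nlinarith
      · obtain rfl : q = 3 := le_antisymm h hq
        have : k ≠ 2 := fun h => hqk ⟨rfl, h⟩
        omega
    have h' : (2 : ℝ) * k + 2 < k * q := by exact_mod_cast h
    linarith
  rw [← Ioc_union_Ioi_eq_Ioi (zero_le_one' ℝ)]
  refine IntegrableOn.union ?_ ?_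
  · refine (integrableOn_const (C := (1 : ℝ)) (by simp)).congr_fun ?_ measurableSet_Ioc
    intro x hx
    simp [decayBound, hx.2]
  · have h : IntegrableOn (fun ψ : ℝ => M ^ ((q : ℝ) / 2) * ψ ^ ((k : ℝ) - k * q / 2)) (Ioi 1) :=
      (integrableOn_Ioi_rpow_of_lt hexp one_pos).const_mul _
    refine h.congr_fun ?_ measurableSet_Ioi
    intro x hx
    simp [decayBound, not_le.2 (mem_Ioi.1 hx)]

theorem abs_pow_mul_le_decayBound {M x ψ : ℝ} (q k : ℕ) (hψ : 0 < ψ) (hx : |x| ≤ 1)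
    (hM : x ^ 2 * ψ ^ k ≤ M) : |x| ^ q * ψ ^ k ≤ decayBound M q k ψ := by
  rw [decayBound]
  split_ifs with h
  · exact mul_le_one₀ (pow_le_one₀ (abs_nonneg x) hx) (by positivity) (pow_le_one₀ hψ.le h)
  · have hM0 : 0 ≤ M := le_trans (by positivity) hM
    have h1 : x ^ 2 ≤ M * ψ ^ (-(k : ℝ)) := by
      rw [Real.rpow_neg hψ.le, Real.rpow_natCast, ← div_eq_mul_inv, le_div_iff₀ (by positivity)]
      exact hM
    have h2 : |x| ^ q = (x ^ 2) ^ ((q : ℝ) / 2) := by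
      rw [← sq_abs, ← Real.rpow_natCast (|x|) 2, ← Real.rpow_mul (abs_nonneg x),
        ← Real.rpow_natCast]
      congr 1
      push_cast
      ring
    calc |x| ^ q * ψ ^ k ≤ (M * ψ ^ (-(k : ℝ))) ^ ((q : ℝ) / 2) * ψ ^ k := by
          rw [h2]; gcongr
      _ = M ^ ((q : ℝ) / 2) * (ψ ^ (-(k : ℝ) * ((q : ℝ) / 2)) * ψ ^ (k : ℝ)) := by
          rw [Real.mul_rpow hM0 (by positivity), ← Real.rpow_mul hψ.le, Real.rpow_natCast]
          ring
      _ = _ := by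
          rw [← Real.rpow_add hψ]
          congr 2
          ring

/-- The normalized integrand `B_a(ψ²)^q ψ^k`. -/
noncomputable def besselBIntegrand (a : ℝ) (q k : ℕ) (ψ : ℝ) : ℝ :=
  besselB a (ψ ^ 2) ^ q * ψ ^ k

theorem continuous_besselBIntegrand {a : ℝ} (ha : 1 ≤ a) (q k : ℕ) :
    Continuous (besselBIntegrand a q k) :=
  (((continuous_besselB ha).comp (continuous_pow 2)).pow q).mul (continuous_pow k)

theorem abs_besselBIntegrand_le {a : ℝ} (ha : 3 / 2 ≤ a) {k : ℕ} (hk : (k : ℝ) = 2 * a - 1) (q : ℕ)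
    {ψ : ℝ} (hψ : 0 < ψ) :
    |besselBIntegrand a q k ψ| ≤ decayBound (4 * (2 * Real.pi * a) ^ k) q k ψ := by
  rw [besselBIntegrand, abs_mul, abs_pow, abs_of_pos (pow_pos hψ k)]
  exact abs_pow_mul_le_decayBound q k hψ (abs_besselB_le_one (by linarith) (sq_nonneg ψ))
    (besselB_sq_mul_le ha hk hψ.le)

theorem integrableOn_besselBIntegrand {a : ℝ} (ha : 3 / 2 ≤ a) {q k : ℕ}
    (hk : (k : ℝ) = 2 * a - 1) (hq : 3 ≤ q) (hqk : ¬(q = 3 ∧ k = 2)) :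
    IntegrableOn (besselBIntegrand a q k) (Ioi 0) := by
  have hk2 : 2 ≤ k := by
    have : (2 : ℝ) ≤ k := by linarith
    exact_mod_cast this
  refine Integrable.mono' (integrableOn_decayBound (4 * (2 * Real.pi * a) ^ k) hq hk2 hqk)
    (continuous_besselBIntegrand (by linarith) q k).aestronglyMeasurable ?_
  filter_upwards [ae_restrict_mem measurableSet_Ioi] with ψ hψ
  exact abs_besselBIntegrand_le ha hk q hψ

theorem tendsto_natCast_mul_sin_div (ψ : ℝ) :
    Tendsto (fun n : ℕ => (n : ℝ) * Real.sin (ψ / n)) atTop (𝓝 ψ) := by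
  have h1 : Tendsto (fun n : ℕ => Real.sinc (ψ / n)) atTop (𝓝 1) := by
    simpa [Function.comp_def] using
      (Real.continuous_sinc.tendsto 0).comp (tendsto_const_div_atTop_nhds_zero_nat ψ)
  have h2 := h1.const_mul ψ
  rw [mul_one] at h2
  refine h2.congr' ?_
  filter_upwards [eventually_gt_atTop 0] with n hn
  have hn' : (n : ℝ) ≠ 0 := by positivity
  rcases eq_or_ne ψ 0 with rfl | hψ
  · simp
  · rw [Real.sinc_of_ne_zero (by positivity)]
    field_simp

theorem natCast_pow_mul_integral_eq (a : ℝ) (q k : ℕ) {n : ℕ} (hn : 1 ≤ n) :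
    (n : ℝ) ^ (k + 1) * ∫ θ in (0)..(Real.pi / 2), gegAngle a n θ ^ q * Real.sin θ ^ k =
      ∫ ψ in Ioi 0, (Ioc 0 (n * (Real.pi / 2))).indicator
        (fun ψ => gegAngle a n (ψ / n) ^ q * (n * Real.sin (ψ / n)) ^ k) ψ := by
  have hn' : (0 : ℝ) < n := by exact_mod_cast hn
  have hpi := Real.pi_pos
  rw [setIntegral_indicator measurableSet_Ioc, inter_eq_right.2 Ioc_subset_Ioi_self,
    ← intervalIntegral.integral_of_le (by positivity)]
  have h := intervalIntegral.integral_comp_div (a := 0) (b := n * (Real.pi / 2))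
    (fun θ => gegAngle a n θ ^ q * (n * Real.sin θ) ^ k) hn'.ne'
  rw [h, zero_div, mul_div_cancel_left₀ _ hn'.ne', smul_eq_mul]
  simp_rw [mul_pow, mul_left_comm _ ((n : ℝ) ^ k)]
  rw [intervalIntegral.integral_const_mul]
  ring

theorem tendsto_pow_mul_integral_gegAngle {a : ℝ} (ha : 3 / 2 ≤ a) {q k : ℕ}
    (hk : (k : ℝ) = 2 * a - 1) (hq : 3 ≤ q) (hqk : ¬(q = 3 ∧ k = 2)) :
    Tendsto (fun n : ℕ => (n : ℝ) ^ (k + 1) *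
      ∫ θ in (0)..(Real.pi / 2), gegAngle a n θ ^ q * Real.sin θ ^ k) atTop
      (𝓝 (∫ ψ in Ioi 0, besselBIntegrand a q k ψ)) := by
  have hk2 : 2 ≤ k := by
    have : (2 : ℝ) ≤ k := by linarith
    exact_mod_cast this
  have ha1 : 1 ≤ a := by linarith
  have hpi := Real.pi_pos
  have key : Tendsto (fun n : ℕ => ∫ ψ in Ioi 0, (Ioc 0 (n * (Real.pi / 2))).indicator
      (fun ψ => gegAngle a n (ψ / n) ^ q * (n * Real.sin (ψ / n)) ^ k) ψ) atTop
      (𝓝 (∫ ψ in Ioi 0, besselBIntegrand a q k ψ)) := by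
    refine tendsto_integral_filter_of_dominated_convergence
      (decayBound (4 * (2 * Real.pi * a) ^ k) q k) ?_ ?_
      (integrableOn_decayBound _ hq hk2 hqk) ?_
    · refine Eventually.of_forall fun n => ?_
      refine AEStronglyMeasurable.indicator ?_ measurableSet_Ioc
      have hc : Continuous fun ψ : ℝ =>
          gegAngle a n (ψ / n) ^ q * (n * Real.sin (ψ / n)) ^ k := by
        have := continuous_gegAngle a n
        fun_prop
      exact hc.aestronglyMeasurable
    · filter_upwards [eventually_ge_atTop 1] with n hn
      filter_upwards [ae_restrict_mem measurableSet_Ioi] with ψ hψ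
      have hψ0 : 0 < ψ := hψ
      have hn' : (0 : ℝ) < n := by exact_mod_cast hn
      by_cases hmem : ψ ∈ Ioc 0 (n * (Real.pi / 2))
      · rw [indicator_of_mem hmem]
        have h0 : 0 ≤ ψ / n := by positivity
        have h1 : ψ / n ≤ Real.pi / 2 := by
          rw [div_le_iff₀ hn', mul_comm]; exact hmem.2
        have hs0 : 0 ≤ Real.sin (ψ / n) := Real.sin_nonneg_of_nonneg_of_le_pi h0 (by linarith)
        have hs1 : n * Real.sin (ψ / n) ≤ ψ := by
          calc n * Real.sin (ψ / n) ≤ n * (ψ / n) := by gcongr; exact Real.sin_le h0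
            _ = ψ := by field_simp
        have hM := gegAngle_sq_mul_le ha hk hn h0 h1
        rw [mul_div_cancel₀ _ hn'.ne'] at hM
        rw [norm_mul, norm_pow, Real.norm_eq_abs,
          Real.norm_of_nonneg (by positivity : 0 ≤ (n * Real.sin (ψ / n)) ^ k)]
        calc _ ≤ |gegAngle a n (ψ / n)| ^ q * ψ ^ k := by gcongr
          _ ≤ _ := abs_pow_mul_le_decayBound q k hψ0 (abs_gegAngle_le_one ha1 hn h0 h1) hM
      · rw [indicator_of_notMem hmem, norm_zero]
        -- Outside the interval only nonnegativity of the majorant is needed; it follows because the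
        -- majorant dominates an absolute value.
        exact (abs_nonneg _).trans (abs_besselBIntegrand_le ha hk q hψ0)
    · filter_upwards [ae_restrict_mem measurableSet_Ioi] with ψ hψ
      have hψ0 : 0 < ψ := hψ
      have hlim := ((tendsto_gegAngle_div ha1 ψ).pow q).mul
        ((tendsto_natCast_mul_sin_div ψ).pow k)
      refine hlim.congr' ?_
      filter_upwards [eventually_div_natCast_mem ψ hψ0.le] with n hn
      have hn' : (0 : ℝ) < n := by exact_mod_cast hn.1
      rw [indicator_of_mem]
      refine ⟨hψ0, ?_⟩
      have := hn.2.2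
      rwa [div_le_iff₀ hn', mul_comm] at this
  refine key.congr' ?_
  filter_upwards [eventually_ge_atTop 1] with n hn
  exact (natCast_pow_mul_integral_eq a q k hn).symm

/-! ### The product formula for Bessel functions -/

theorem hasDerivAt_intervalIntegral_of_continuous {F F' : ℝ → ℝ → ℝ}
    (hF : Continuous (Function.uncurry F)) (hF' : Continuous (Function.uncurry F'))
    (h : ∀ x t, HasDerivAt (fun x => F x t) (F' x t) x) (u v x₀ : ℝ) :
    HasDerivAt (fun x => ∫ t in u..v, F x t) (∫ t in u..v, F' x₀ t) x₀ := by
  have hK : IsCompact (Metric.closedBall x₀ 1 ×ˢ uIcc u v) :=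
    (isCompact_closedBall x₀ 1).prod isCompact_uIcc
  obtain ⟨C, hC⟩ := hK.exists_bound_of_continuousOn hF'.continuousOn
  have hsec : ∀ x, Continuous (F x) := fun x => hF.comp (Continuous.prodMk_right x)
  have hsec' : ∀ x, Continuous (F' x) := fun x => hF'.comp (Continuous.prodMk_right x)
  exact (intervalIntegral.hasDerivAt_integral_of_dominated_loc_of_deriv_le
    (bound := fun _ => C) (Metric.closedBall_mem_nhds x₀ one_pos)
    (Eventually.of_forall fun x => (hsec x).aestronglyMeasurable)
    ((hsec x₀).intervalIntegrable _ _) (hsec' x₀).aestronglyMeasurable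
    (Eventually.of_forall fun t ht x hx => hC (x, t) ⟨hx, uIoc_subset_uIcc ht⟩)
    intervalIntegrable_const (Eventually.of_forall fun t _ x _ => h x t)).2

/-- A solution of `ρ D'' + c D' + y ρ D = 0` with `c > 0`, `y > 0` and `D 0 = 0` vanishes on
`[0, ∞)`. -/
theorem eq_zero_of_bessel_ode {D D' D'' : ℝ → ℝ} {c y : ℝ} (hc : 0 < c) (hy : 0 < y)
    (h1 : ∀ x, HasDerivAt D (D' x) x) (h2 : ∀ x, HasDerivAt D' (D'' x) x)
    (hode : ∀ x, x * D'' x + c * D' x + y * x * D x = 0) (h0 : D 0 = 0) {x : ℝ} (hx : 0 ≤ x) :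
    D x = 0 := by
  -- At the singular point the equation itself forces `D'(0) = 0`, so one initial condition is
  -- enough.
  have h0' : D' 0 = 0 := by
    have := hode 0
    simp only [zero_mul, mul_zero, zero_add, add_zero, mul_eq_zero] at this
    exact this.resolve_left hc.ne'
  have hd : ∀ x, HasDerivAt (fun x => D' x ^ 2 + y * D x ^ 2)
      (2 * D' x * D'' x + y * (2 * D x * D' x)) x := fun x =>
    (((h2 x).pow 2).add (((h1 x).pow 2).const_mul y)).congr_deriv (by simp)
  have hanti : AntitoneOn (fun x => D' x ^ 2 + y * D x ^ 2) (Ici 0) := by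
    apply antitoneOn_of_deriv_nonpos (convex_Ici _)
    · exact fun x _ => (hd x).continuousAt.continuousWithinAt
    · exact fun x _ => (hd x).differentiableAt.differentiableWithinAt
    · intro x hx
      rw [interior_Ici] at hx
      have hx' : 0 < x := hx
      rw [(hd x).deriv]
      by_contra! hpos
      have h3 := mul_pos hx' hpos
      have h4 : x * (2 * D' x * D'' x + y * (2 * D x * D' x)) = -2 * (c * D' x ^ 2) := by
        linear_combination 2 * D' x * hode x
      have h5 : 0 ≤ c * D' x ^ 2 := by positivity
      linarith
  have h := hanti (mem_Ici.2 le_rfl) (mem_Ici.2 hx) hx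
  simp only [h0, h0'] at h
  have h6 : y * D x ^ 2 ≤ 0 := by nlinarith [sq_nonneg (D' x)]
  have h7 : D x ^ 2 ≤ 0 := by
    by_contra! h8
    nlinarith [mul_pos hy h8]
  exact pow_eq_zero_iff two_ne_zero |>.1 (le_antisymm h7 (sq_nonneg _))

/-- The ultraspherical weight `(1 - t²)^(a - 3/2)`. -/
noncomputable def ultraWeight (a t : ℝ) : ℝ := (1 - t ^ 2) ^ (a - 3 / 2)

/-- The total mass of the ultraspherical weight. -/
noncomputable def ultraMass (a : ℝ) : ℝ := ∫ t in (-1)..1, ultraWeight a t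

theorem continuous_ultraWeight {a : ℝ} (ha : 3 / 2 ≤ a) : Continuous (ultraWeight a) :=
  (by fun_prop : Continuous fun t : ℝ => 1 - t ^ 2).rpow_const
    fun _ => Or.inr (by linarith)

theorem hasDerivAt_mul_ultraWeight {a : ℝ} (ha : 3 / 2 ≤ a) (t : ℝ) :
    HasDerivAt (fun t : ℝ => (1 - t ^ 2) ^ (a - 1 / 2))
      (-((2 * a - 1) * t * ultraWeight a t)) t := by
  have h : HasDerivAt (fun t : ℝ => 1 - t ^ 2) (-(2 * t)) t := by
    simpa using ((hasDerivAt_id t).pow 2).const_sub 1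
  refine (h.rpow_const (p := a - 1 / 2) (Or.inr (by linarith))).congr_deriv ?_
  rw [ultraWeight, show a - 1 / 2 - 1 = a - 3 / 2 by ring]
  ring

theorem mul_ultraWeight {a : ℝ} (ha : 3 / 2 ≤ a) {t : ℝ} (ht : t ∈ Icc (-1 : ℝ) 1) :
    (1 - t ^ 2) * ultraWeight a t = (1 - t ^ 2) ^ (a - 1 / 2) := by
  have h0 : 0 ≤ 1 - t ^ 2 := by nlinarith [ht.1, ht.2]
  rw [ultraWeight, show a - 1 / 2 = 1 + (a - 3 / 2) by ring,
    Real.rpow_add_of_nonneg h0 zero_le_one (by linarith), Real.rpow_one]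

/-- The first derivative of `s ↦ besselB a (y s)`. -/
noncomputable def besselB1 (a y s : ℝ) : ℝ := -(y / (4 * a)) * besselB (a + 1) (y * s)

/-- The second derivative of `s ↦ besselB a (y s)`. -/
noncomputable def besselB2 (a y s : ℝ) : ℝ :=
  y ^ 2 / (16 * a * (a + 1)) * besselB (a + 2) (y * s)

theorem hasDerivAt_besselB_mul {a : ℝ} (ha : 1 ≤ a) (y s : ℝ) :
    HasDerivAt (fun s => besselB a (y * s)) (besselB1 a y s) s := by
  refine ((hasDerivAt_besselB ha (y * s)).comp s ((hasDerivAt_id s).const_mul y)).congr_deriv ?_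
  rw [besselB1]
  ring

theorem hasDerivAt_besselB1 {a : ℝ} (ha : 1 ≤ a) (y s : ℝ) :
    HasDerivAt (besselB1 a y) (besselB2 a y s) s := by
  refine ((hasDerivAt_besselB_mul (by linarith : 1 ≤ a + 1) y s).const_mul _).congr_deriv ?_
  have : a ≠ 0 := by linarith
  have : a + 1 ≠ 0 := by linarith
  rw [besselB1, besselB2, show a + 1 + 1 = a + 2 by ring]
  field_simp
  ring

theorem besselB_ode {a : ℝ} (ha : 1 ≤ a) (y s : ℝ) :
    4 * s * besselB2 a y s + 4 * a * besselB1 a y s + y * besselB a (y * s) = 0 := by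
  have h := besselB_contiguous ha (y * s)
  have : a ≠ 0 := by linarith
  have : a + 1 ≠ 0 := by linarith
  have e : 4 * s * besselB2 a y s = y * (y * s / (4 * a * (a + 1)) * besselB (a + 2) (y * s)) := by
    rw [besselB2]
    field_simp
    ring
  have e1 : 4 * a * besselB1 a y s = -y * besselB (a + 1) (y * s) := by
    rw [besselB1]
    field_simp
  rw [e, e1, ← h]
  ring

theorem continuous_besselB1 {a : ℝ} (ha : 1 ≤ a) (y : ℝ) : Continuous (besselB1 a y) :=
  ((continuous_besselB (by linarith)).comp (continuous_const.mul continuous_id)).const_smul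
    (-(y / (4 * a)))

theorem continuous_besselB2 {a : ℝ} (ha : 1 ≤ a) (y : ℝ) : Continuous (besselB2 a y) :=
  ((continuous_besselB (by linarith)).comp (continuous_const.mul continuous_id)).const_smul
    (y ^ 2 / (16 * a * (a + 1)))

/-- Geometrically, the left side averages a radial eigenfunction of the Laplacian over a sphere of
radius `ρ` centred at distance `1` from the origin. As functions of `ρ`, both sides solve the same
singular Bessel equation and agree at `ρ = 0`, so uniqueness identifies them. -/
theorem besselB_product_formula {a : ℝ} (ha : 3 / 2 ≤ a) {y ρ : ℝ} (hy : 0 < y) (hρ : 0 ≤ ρ) :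
    ∫ t in (-1)..1, besselB a (y * (1 + ρ ^ 2 + 2 * ρ * t)) * ultraWeight a t =
      ultraMass a * (besselB a y * besselB a (y * ρ ^ 2)) := by
  have ha1 : 1 ≤ a := by linarith
  have hw := continuous_ultraWeight ha
  have hB := continuous_besselB ha1
  have hB1 := continuous_besselB1 ha1 y
  have hB2 := continuous_besselB2 ha1 y
  let F : ℝ → ℝ → ℝ := fun ρ t => besselB a (y * (1 + ρ ^ 2 + 2 * ρ * t)) * ultraWeight a t
  let F1 : ℝ → ℝ → ℝ := fun ρ t =>
    besselB1 a y (1 + ρ ^ 2 + 2 * ρ * t) * (2 * ρ + 2 * t) * ultraWeight a t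
  let F2 : ℝ → ℝ → ℝ := fun ρ t =>
    (besselB2 a y (1 + ρ ^ 2 + 2 * ρ * t) * (2 * ρ + 2 * t) ^ 2 +
      besselB1 a y (1 + ρ ^ 2 + 2 * ρ * t) * 2) * ultraWeight a t
  have hFc : Continuous (Function.uncurry F) := by
    simp only [F, Function.uncurry_def]; fun_prop
  have hF1c : Continuous (Function.uncurry F1) := by
    simp only [F1, Function.uncurry_def]; fun_prop
  have hF2c : Continuous (Function.uncurry F2) := by
    simp only [F2, Function.uncurry_def]; fun_prop
  have harg : ∀ ρ t : ℝ, HasDerivAt (fun ρ : ℝ => 1 + ρ ^ 2 + 2 * ρ * t) (2 * ρ + 2 * t) ρ := by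
    intro ρ t
    exact ((((hasDerivAt_id ρ).pow 2).const_add 1).add
      (((hasDerivAt_id ρ).const_mul 2).mul_const t)).congr_deriv (by simp)
  have hF1 : ∀ ρ t, HasDerivAt (fun ρ => F ρ t) (F1 ρ t) ρ := fun ρ t =>
    ((hasDerivAt_besselB_mul ha1 y _).comp ρ (harg ρ t)).mul_const _
  have hlin : ∀ ρ t : ℝ, HasDerivAt (fun ρ : ℝ => 2 * ρ + 2 * t) 2 ρ := fun ρ t => by
    simpa using ((hasDerivAt_id ρ).const_mul 2).add_const (2 * t)
  have hF2 : ∀ ρ t, HasDerivAt (fun ρ => F1 ρ t) (F2 ρ t) ρ := fun ρ t =>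
    ((((hasDerivAt_besselB1 ha1 y _).comp ρ (harg ρ t)).mul (hlin ρ t)).mul_const
      (ultraWeight a t)).congr_deriv (by simp only [F2, Function.comp_apply]; ring)
  let V : ℝ → ℝ := fun ρ => ∫ t in (-1)..1, F ρ t
  let V1 : ℝ → ℝ := fun ρ => ∫ t in (-1)..1, F1 ρ t
  let V2 : ℝ → ℝ := fun ρ => ∫ t in (-1)..1, F2 ρ t
  have hV1 : ∀ ρ, HasDerivAt V (V1 ρ) ρ := fun ρ =>
    hasDerivAt_intervalIntegral_of_continuous hFc hF1c hF1 _ _ ρ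
  have hV2 : ∀ ρ, HasDerivAt V1 (V2 ρ) ρ := fun ρ =>
    hasDerivAt_intervalIntegral_of_continuous hF1c hF2c hF2 _ _ ρ
  have hVode : ∀ ρ, ρ * V2 ρ + (2 * a - 1) * V1 ρ + y * ρ * V ρ = 0 := by
    intro ρ
    -- By the Bessel equation, the integrand of the equation for `V` is `-2` times the
    -- `t`-derivative of `P`, and `P` vanishes at `±1`.
    let P : ℝ → ℝ := fun t => (1 - t ^ 2) ^ (a - 1 / 2) * besselB1 a y (1 + ρ ^ 2 + 2 * ρ * t)
    have hargt : ∀ t : ℝ, HasDerivAt (fun t : ℝ => 1 + ρ ^ 2 + 2 * ρ * t) (2 * ρ) t := fun t => by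
      simpa using ((hasDerivAt_id t).const_mul (2 * ρ)).const_add (1 + ρ ^ 2)
    have hP : ∀ t, HasDerivAt P (-((2 * a - 1) * t * ultraWeight a t) *
        besselB1 a y (1 + ρ ^ 2 + 2 * ρ * t) + (1 - t ^ 2) ^ (a - 1 / 2) *
        (besselB2 a y (1 + ρ ^ 2 + 2 * ρ * t) * (2 * ρ))) t := fun t =>
      (hasDerivAt_mul_ultraWeight ha t).mul ((hasDerivAt_besselB1 ha1 y _).comp t (hargt t))
    have hPcont : Continuous fun t : ℝ => -((2 * a - 1) * t * ultraWeight a t) *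
        besselB1 a y (1 + ρ ^ 2 + 2 * ρ * t) + (1 - t ^ 2) ^ (a - 1 / 2) *
        (besselB2 a y (1 + ρ ^ 2 + 2 * ρ * t) * (2 * ρ)) := by
      have hp : Continuous fun t : ℝ => (1 - t ^ 2) ^ (a - 1 / 2) :=
        (by fun_prop : Continuous fun t : ℝ => 1 - t ^ 2).rpow_const
          fun _ => Or.inr (by linarith)
      fun_prop
    have hint := intervalIntegral.integral_eq_sub_of_hasDerivAt (fun t _ => hP t)
      (hPcont.intervalIntegrable (-1) 1)
    have hz : P 1 - P (-1) = 0 := by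
      have e1 : (1 : ℝ) - 1 ^ 2 = 0 := by norm_num
      have e2 : (1 : ℝ) - (-1) ^ 2 = 0 := by norm_num
      simp only [P, e1, e2, Real.zero_rpow (by linarith : a - 1 / 2 ≠ 0), zero_mul, sub_self]
    rw [hz] at hint
    have i0 : IntervalIntegrable (F ρ) volume (-1) 1 :=
      (hFc.comp (Continuous.prodMk_right ρ)).intervalIntegrable _ _
    have i1 : IntervalIntegrable (F1 ρ) volume (-1) 1 :=
      (hF1c.comp (Continuous.prodMk_right ρ)).intervalIntegrable _ _
    have i2 : IntervalIntegrable (F2 ρ) volume (-1) 1 :=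
      (hF2c.comp (Continuous.prodMk_right ρ)).intervalIntegrable _ _
    simp only [V, V1, V2]
    rw [← intervalIntegral.integral_const_mul, ← intervalIntegral.integral_const_mul,
      ← intervalIntegral.integral_const_mul,
      ← intervalIntegral.integral_add (i2.const_mul _) (i1.const_mul _),
      ← intervalIntegral.integral_add ((i2.const_mul _).add (i1.const_mul _)) (i0.const_mul _),
      ← mul_zero (-2 : ℝ), ← hint, ← intervalIntegral.integral_const_mul]
    refine intervalIntegral.integral_congr fun t ht => ?_
    rw [uIcc_of_le (by norm_num)] at ht
    simp only [F, F1, F2, ← mul_ultraWeight ha ht]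
    linear_combination (ρ * ultraWeight a t) * besselB_ode ha1 y (1 + ρ ^ 2 + 2 * ρ * t)
  let c := ultraMass a * besselB a y
  let U : ℝ → ℝ := fun ρ => c * besselB a (y * ρ ^ 2)
  let U1 : ℝ → ℝ := fun ρ => c * (besselB1 a y (ρ ^ 2) * (2 * ρ))
  let U2 : ℝ → ℝ := fun ρ => c * (besselB2 a y (ρ ^ 2) * (2 * ρ) * (2 * ρ) +
    besselB1 a y (ρ ^ 2) * 2)
  have hsq : ∀ ρ : ℝ, HasDerivAt (fun ρ : ℝ => ρ ^ 2) (2 * ρ) ρ := fun ρ => by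
    simpa using hasDerivAt_pow 2 ρ
  have hU1 : ∀ ρ, HasDerivAt U (U1 ρ) ρ := fun ρ =>
    ((hasDerivAt_besselB_mul ha1 y _).comp ρ (hsq ρ)).const_mul c
  have hU2 : ∀ ρ, HasDerivAt U1 (U2 ρ) ρ := fun ρ =>
    ((((hasDerivAt_besselB1 ha1 y _).comp ρ (hsq ρ)).mul
      ((hasDerivAt_id ρ).const_mul 2)).const_mul c).congr_deriv (by simp [U2])
  have h := eq_zero_of_bessel_ode (D := fun ρ => V ρ - U ρ) (c := 2 * a - 1) (by linarith) hy
    (fun ρ => (hV1 ρ).sub (hU1 ρ)) (fun ρ => (hV2 ρ).sub (hU2 ρ))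
    (fun ρ => by
      have h2 := besselB_ode ha1 y (ρ ^ 2)
      simp only [U, U1, U2]
      linear_combination hVode ρ - c * ρ * h2)
    (by
      simp only [V, U, F, c, ultraMass]
      simp [besselB_zero, mul_comm]) hρ
  simp only [V, U, c, F] at h
  linarith

/-! ### Gaussian-regularized Hankel transforms and positivity of the constant -/

theorem pow_mul_exp_eq_rpow (k : ℕ) (b x : ℝ) :
    x ^ k * Real.exp (-b * x ^ 2) = x ^ (k : ℝ) * Real.exp (-b * x ^ (2 : ℝ)) := by
  rw [Real.rpow_natCast, Real.rpow_two]

theorem integrableOn_pow_mul_exp {b : ℝ} (hb : 0 < b) (k : ℕ) :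
    IntegrableOn (fun x : ℝ => x ^ k * Real.exp (-b * x ^ 2)) (Ioi 0) := by
  simp_rw [pow_mul_exp_eq_rpow]
  exact integrableOn_rpow_mul_exp_neg_mul_rpow
    (by have : (0 : ℝ) ≤ k := k.cast_nonneg
        linarith) two_pos hb

theorem integral_pow_mul_exp {a b : ℝ} (ha : 1 ≤ a) (hb : 0 < b) {k : ℕ}
    (hk : (k : ℝ) = 2 * a - 1) (m : ℕ) :
    ∫ x in Ioi (0 : ℝ), x ^ (2 * m + k) * Real.exp (-b * x ^ 2) =
      Real.Gamma a / 2 * b ^ (-a) * (poch a m / b ^ m) := by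
  have h0 : (0 : ℝ) ≤ ((2 * m + k : ℕ) : ℝ) := Nat.cast_nonneg _
  simp_rw [pow_mul_exp_eq_rpow]
  rw [integral_rpow_mul_exp_neg_mul_rpow two_pos (by linarith) hb]
  push_cast
  have e1 : -(2 * (m : ℝ) + k + 1) / 2 = -a + -(m : ℝ) := by rw [hk]; ring
  have e2 : (2 * (m : ℝ) + k + 1) / 2 = a + m := by rw [hk]; ring
  rw [e1, e2, Gamma_add_nat (by linarith), Real.rpow_add hb, Real.rpow_neg hb.le (m : ℝ),
    Real.rpow_natCast]
  ring

/-- The Gaussian regularization of the Hankel transform of `x ↦ besselB a (x²)^m`. -/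
noncomputable def hankelGauss (a : ℝ) (k : ℕ) (b : ℝ) (m : ℕ) (s : ℝ) : ℝ :=
  ∫ x in Ioi (0 : ℝ), besselB a (x ^ 2 * s) *
    (besselB a (x ^ 2) ^ m * (x ^ k * Real.exp (-b * x ^ 2)))

/-- Integrate the power series termwise: the Gamma factors of the Gaussian moments cancel the rising
factorials and leave an exponential series. -/
theorem hankelGauss_zero {a b : ℝ} (ha : 1 ≤ a) (hb : 0 < b) {k : ℕ} (hk : (k : ℝ) = 2 * a - 1)
    (s : ℝ) :
    hankelGauss a k b 0 s = Real.Gamma a / 2 * b ^ (-a) * Real.exp (-s / (4 * b)) := by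
  let F : ℕ → ℝ → ℝ := fun m x => besselTerm a m (x ^ 2 * s) * (x ^ k * Real.exp (-b * x ^ 2))
  have hF : ∀ m x, F m x = (-s / 4) ^ m / (m ! * poch a m) *
      (x ^ (2 * m + k) * Real.exp (-b * x ^ 2)) := by
    intro m x
    simp only [F, besselTerm]
    rw [show -(x ^ 2 * s) / 4 = x ^ 2 * (-s / 4) by ring, mul_pow, ← pow_mul, pow_add]
    ring
  have hint : ∀ m, ∫ x in Ioi (0 : ℝ), F m x =
      Real.Gamma a / 2 * b ^ (-a) * ((-s / (4 * b)) ^ m / m !) := by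
    intro m
    simp_rw [hF]
    rw [integral_const_mul, integral_pow_mul_exp ha hb hk]
    have hp := (poch_pos ha m).ne'
    rw [show -s / (4 * b) = (-s / 4) / b by field_simp, div_pow (-s / 4) b]
    field_simp
  have hFint : ∀ m, Integrable (F m) (volume.restrict (Ioi 0)) := by
    intro m
    simp_rw [funext (hF m)]
    exact (integrableOn_pow_mul_exp hb _).const_mul _
  have hnorm : ∀ m, ∫ x in Ioi (0 : ℝ), ‖F m x‖ =
      Real.Gamma a / 2 * b ^ (-a) * ((|s| / (4 * b)) ^ m / m !) := by
    intro m
    have hp := poch_pos ha m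
    have e : ∀ x ∈ Ioi (0 : ℝ), ‖F m x‖ = (|s| / 4) ^ m / (m ! * poch a m) *
        (x ^ (2 * m + k) * Real.exp (-b * x ^ 2)) := by
      intro x hx
      have hx' : 0 < x := hx
      rw [hF, norm_mul, Real.norm_of_nonneg (by positivity :
        0 ≤ x ^ (2 * m + k) * Real.exp (-b * x ^ 2)), norm_div, norm_pow, norm_div, norm_neg,
        Real.norm_of_nonneg (by positivity : 0 ≤ (m ! : ℝ) * poch a m), Real.norm_eq_abs s]
      norm_num
    rw [setIntegral_congr_fun measurableSet_Ioi e, integral_const_mul,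
      integral_pow_mul_exp ha hb hk, show |s| / (4 * b) = (|s| / 4) / b by field_simp,
      div_pow (|s| / 4) b]
    field_simp
  have hsum : Summable fun m => ∫ x in Ioi (0 : ℝ), ‖F m x‖ := by
    simp_rw [hnorm]
    exact (Real.summable_pow_div_factorial _).mul_left _
  have h := hasSum_integral_of_summable_integral_norm hFint hsum
  simp_rw [hint] at h
  have hexp : HasSum (fun m : ℕ => Real.Gamma a / 2 * b ^ (-a) * ((-s / (4 * b)) ^ m / m !))
      (Real.Gamma a / 2 * b ^ (-a) * Real.exp (-s / (4 * b))) := by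
    rw [Real.exp_eq_exp_ℝ]
    exact (NormedSpace.expSeries_div_hasSum_exp (-s / (4 * b))).mul_left _
  rw [← h.unique hexp, hankelGauss]
  refine integral_congr_ae (Eventually.of_forall fun x => ?_)
  simp only [F, pow_zero, one_mul, tsum_mul_right]
  rfl

theorem integrable_besselB_pow_mul {a b : ℝ} (ha : 1 ≤ a) (hb : 0 < b) (k m : ℕ) :
    IntegrableOn (fun x : ℝ => besselB a (x ^ 2) ^ m * (x ^ k * Real.exp (-b * x ^ 2)))
      (Ioi 0) := by
  have hB := continuous_besselB ha
  refine Integrable.mono' (integrableOn_pow_mul_exp hb k) (by fun_prop) ?_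
  filter_upwards [ae_restrict_mem measurableSet_Ioi] with x hx
  have hx' : 0 < x := hx
  rw [norm_mul, norm_pow, Real.norm_of_nonneg (by positivity :
    0 ≤ x ^ k * Real.exp (-b * x ^ 2))]
  exact mul_le_of_le_one_left (by positivity)
    (pow_le_one₀ (norm_nonneg _) (abs_besselB_le_one ha (sq_nonneg x)))

theorem one_add_sq_add_nonneg {ρ t : ℝ} (hρ : 0 ≤ ρ) (ht : -1 ≤ t) :
    0 ≤ 1 + ρ ^ 2 + 2 * ρ * t := by
  nlinarith [sq_nonneg (1 - ρ)]

/-- The product formula in integrated form, with the integrability of its integrand. -/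
theorem ultraMass_mul_hankelGauss_succ {a b : ℝ} (ha : 3 / 2 ≤ a) (hb : 0 < b) (k m : ℕ) {ρ : ℝ}
    (hρ : 0 ≤ ρ) :
    IntegrableOn (fun t => ultraWeight a t * hankelGauss a k b m (1 + ρ ^ 2 + 2 * ρ * t))
      (Ioc (-1) 1) ∧
    ultraMass a * hankelGauss a k b (m + 1) (ρ ^ 2) =
      ∫ t in Ioc (-1 : ℝ) 1,
        ultraWeight a t * hankelGauss a k b m (1 + ρ ^ 2 + 2 * ρ * t) := by
  have ha1 : 1 ≤ a := by linarith
  have hB := continuous_besselB ha1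
  have hw := continuous_ultraWeight ha
  let g : ℝ → ℝ := fun x => besselB a (x ^ 2) ^ m * (x ^ k * Real.exp (-b * x ^ 2))
  have hgc : Continuous g := by simp only [g]; fun_prop
  have hg : IntegrableOn g (Ioi 0) := integrable_besselB_pow_mul ha1 hb k m
  let f : ℝ → ℝ → ℝ := fun t x =>
    ultraWeight a t * (besselB a (x ^ 2 * (1 + ρ ^ 2 + 2 * ρ * t)) * g x)
  have hwi : Integrable (ultraWeight a) (volume.restrict (Ioc (-1) 1)) :=
    (hw.integrableOn_Icc (a := -1) (b := 1)).mono_set Ioc_subset_Icc_self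
  have hfi : Integrable (Function.uncurry f)
      ((volume.restrict (Ioc (-1 : ℝ) 1)).prod (volume.restrict (Ioi (0 : ℝ)))) := by
    refine Integrable.mono (hwi.mul_prod hg) ?_ ?_
    · have : Continuous (Function.uncurry f) := by
        simp only [f, Function.uncurry_def]
        fun_prop
      exact this.aestronglyMeasurable
    · rw [Measure.prod_restrict]
      filter_upwards [ae_restrict_mem (measurableSet_Ioc.prod measurableSet_Ioi)] with p hp
      simp only [f, Function.uncurry_def, norm_mul]
      -- Fubini's theorem applies because the Bessel factor is at most `1`, which leaves an
      -- integrable product of a function of `t` and one of `x`.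
      have h1 := abs_besselB_le_one ha1
        (mul_nonneg (sq_nonneg p.2) (one_add_sq_add_nonneg hρ hp.1.1.le))
      gcongr
      exact mul_le_of_le_one_left (norm_nonneg _) h1
  have e : ∀ t, ∫ x in Ioi (0 : ℝ), f t x =
      ultraWeight a t * hankelGauss a k b m (1 + ρ ^ 2 + 2 * ρ * t) := by
    intro t
    simp only [f, hankelGauss, g]
    rw [integral_const_mul]
  constructor
  · have := hfi.integral_prod_left
    simp only [Function.uncurry_apply_pair, e] at this
    exact this
  · simp_rw [← e]
    rw [integral_integral_swap hfi, hankelGauss, ← integral_const_mul]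
    refine setIntegral_congr_fun measurableSet_Ioi fun x hx => ?_
    have hx' : 0 < x ^ 2 := pow_pos hx 2
    have h := besselB_product_formula ha hx' hρ
    rw [intervalIntegral.integral_of_le (by norm_num)] at h
    have e2 : ∀ t, f t x =
        besselB a (x ^ 2 * (1 + ρ ^ 2 + 2 * ρ * t)) * ultraWeight a t * g x := by
      intro t
      simp only [f]
      ring
    simp_rw [e2]
    rw [integral_mul_const, h]
    simp only [g]
    ring

theorem mul_length_le_setIntegral {f : ℝ → ℝ} {u v c : ℝ} (hf : IntegrableOn f (Ioc (-1) 1))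
    (h0 : ∀ t ∈ Ioc (-1 : ℝ) 1, 0 ≤ f t) (hu : -1 ≤ u) (huv : u ≤ v) (hv : v ≤ 1)
    (hc : ∀ t ∈ Ioc u v, c ≤ f t) : c * (v - u) ≤ ∫ t in Ioc (-1 : ℝ) 1, f t := by
  have hsub : Ioc u v ⊆ Ioc (-1 : ℝ) 1 := Ioc_subset_Ioc hu hv
  calc c * (v - u) = ∫ _ in Ioc u v, c := by
        simp [Measure.real, huv, mul_comm]
    _ ≤ ∫ t in Ioc u v, f t :=
        setIntegral_mono_on (integrableOn_const (by simp)) (hf.mono_set hsub) measurableSet_Ioc hc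
    _ ≤ _ := setIntegral_mono_set hf
        ((ae_restrict_mem measurableSet_Ioc).mono fun t ht => h0 t ht) hsub.eventuallyLE

theorem ultraWeight_nonneg (a : ℝ) {t : ℝ} (ht : t ∈ Icc (-1 : ℝ) 1) : 0 ≤ ultraWeight a t :=
  Real.rpow_nonneg (by nlinarith [ht.1, ht.2]) _

theorem le_ultraWeight {a c t : ℝ} (ha : 3 / 2 ≤ a) (hc : 0 ≤ c) (h : c ≤ 1 - t ^ 2) :
    c ^ (a - 3 / 2) ≤ ultraWeight a t :=
  Real.rpow_le_rpow hc h (by linarith)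

theorem ultraMass_pos {a : ℝ} (ha : 3 / 2 ≤ a) : 0 < ultraMass a := by
  have hw : IntegrableOn (ultraWeight a) (Ioc (-1) 1) :=
    ((continuous_ultraWeight ha).integrableOn_Icc (a := -1) (b := 1)).mono_set Ioc_subset_Icc_self
  have h := mul_length_le_setIntegral (u := 0) (v := 1 / 2) (c := (1 / 2) ^ (a - 3 / 2)) hw
    (fun t ht => ultraWeight_nonneg a (Ioc_subset_Icc_self ht)) (by norm_num) (by norm_num)
    (by norm_num)
    (fun t ht => le_ultraWeight ha (by norm_num) (by nlinarith [ht.1, ht.2]))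
  rw [ultraMass, intervalIntegral.integral_of_le (by norm_num)]
  refine lt_of_lt_of_le ?_ h
  have : (0 : ℝ) < (1 / 2) ^ (a - 3 / 2) := Real.rpow_pos_of_pos (by norm_num) _
  nlinarith

/-- The transform for `m = 0` is a positive Gaussian, and each further one is a weighted average of
its predecessor. -/
theorem hankelGauss_nonneg {a b : ℝ} (ha : 3 / 2 ≤ a) (hb : 0 < b) {k : ℕ}
    (hk : (k : ℝ) = 2 * a - 1) (m : ℕ) {s : ℝ} (hs : 0 ≤ s) : 0 ≤ hankelGauss a k b m s := by
  induction m generalizing s with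
  | zero =>
    have := Real.Gamma_pos_of_pos (by linarith : 0 < a)
    rw [hankelGauss_zero (by linarith) hb hk]
    positivity
  | succ m ih =>
    have h := (ultraMass_mul_hankelGauss_succ ha hb k m (Real.sqrt_nonneg s)).2
    rw [Real.sq_sqrt hs] at h
    have h2 : 0 ≤ ultraMass a * hankelGauss a k b (m + 1) s := by
      rw [h]
      refine setIntegral_nonneg measurableSet_Ioc fun t ht => ?_
      have hnn := one_add_sq_add_nonneg (Real.sqrt_nonneg s) ht.1.le
      rw [Real.sq_sqrt hs] at hnn
      exact mul_nonneg (ultraWeight_nonneg a (Ioc_subset_Icc_self ht)) (ih hnn)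
    exact nonneg_of_mul_nonneg_right h2 (ultraMass_pos ha)

theorem hankelGauss_succ_ge {a b : ℝ} (ha : 3 / 2 ≤ a) (hb : 0 < b) {k : ℕ}
    (hk : (k : ℝ) = 2 * a - 1) (m : ℕ) {s u v c : ℝ} (hs : 0 ≤ s) (hu : -1 ≤ u) (huv : u ≤ v)
    (hv : v ≤ 1) (hc : ∀ t ∈ Ioc u v, c ≤ ultraWeight a t *
      hankelGauss a k b m (1 + s + 2 * Real.sqrt s * t)) :
    c * (v - u) ≤ ultraMass a * hankelGauss a k b (m + 1) s := by
  obtain ⟨hint, h⟩ := ultraMass_mul_hankelGauss_succ ha hb k m (Real.sqrt_nonneg s)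
  rw [Real.sq_sqrt hs] at h hint
  rw [h]
  refine mul_length_le_setIntegral hint (fun t ht => ?_) hu huv hv hc
  have hnn := one_add_sq_add_nonneg (Real.sqrt_nonneg s) ht.1.le
  rw [Real.sq_sqrt hs] at hnn
  exact mul_nonneg (ultraWeight_nonneg a (Ioc_subset_Icc_self ht))
    (hankelGauss_nonneg ha hb hk m hnn)

/-- This transform is a smoothed sphere. For `|s - 1| ≤ √b` and `1 + t` between `b/2` and `b`, the
argument `(1 - ρ)² + 2ρ(1 + t)` stays below `4b`, so the Gaussian is at least `e⁻¹ b^(-a)` up to the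
Gamma factor. That cap has weight of order `b^(a - 1/2)`, which leaves height `1/√b`. -/
theorem hankelGauss_one_ge {a b : ℝ} (ha : 3 / 2 ≤ a) (hb : 0 < b) (hb1 : b ≤ 1 / 16) {k : ℕ}
    (hk : (k : ℝ) = 2 * a - 1) {s : ℝ} (hs0 : 0 ≤ s) (hs : |s - 1| ≤ Real.sqrt b) :
    Real.Gamma a / 2 * Real.exp (-1) * (1 / 2) ^ (a - 1 / 2) / Real.sqrt b ≤
      ultraMass a * hankelGauss a k b 1 s := by
  have hG := Real.Gamma_pos_of_pos (by linarith : 0 < a)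
  set ρ := Real.sqrt s with hρ
  have hρ0 : 0 ≤ ρ := Real.sqrt_nonneg s
  have hρs : ρ ^ 2 = s := Real.sq_sqrt hs0
  have hsb : Real.sqrt b ^ 2 = b := Real.sq_sqrt hb.le
  have hsb0 : 0 < Real.sqrt b := Real.sqrt_pos.2 hb
  have hsb1 : Real.sqrt b ≤ 1 / 4 := by nlinarith
  have hab := abs_le.1 hs
  have hρ1 : ρ ≤ 5 / 4 := by nlinarith
  have hdiff : (1 - ρ) ^ 2 ≤ b := by
    have h1 : (s - 1) ^ 2 ≤ b := by rw [← hsb, sq_le_sq, abs_of_pos hsb0]; exact hs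
    have h2 : (s - 1) ^ 2 = (1 - ρ) ^ 2 * (1 + ρ) ^ 2 := by rw [← hρs]; ring
    have h3 : 1 ≤ (1 + ρ) ^ 2 := by nlinarith
    nlinarith [sq_nonneg (1 - ρ)]
  have h := hankelGauss_succ_ge ha hb hk 0 (u := -1 + b / 2) (v := -1 + b)
    (c := (b / 2) ^ (a - 3 / 2) * (Real.Gamma a / 2 * b ^ (-a) * Real.exp (-1))) hs0
    (by linarith) (by linarith) (by linarith) (by
      intro t ht
      have hw : (b / 2) ^ (a - 3 / 2) ≤ ultraWeight a t :=
        le_ultraWeight ha (by positivity) (by nlinarith [ht.1, ht.2])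
      rw [hankelGauss_zero (by linarith) hb hk]
      have hexp : -1 ≤ -(1 + s + 2 * Real.sqrt s * t) / (4 * b) := by
        rw [le_div_iff₀ (by positivity), ← hρ, ← hρs]
        have : ρ * (1 + t) ≤ 5 / 4 * b := by
          have h1 : 0 ≤ 1 + t := by linarith [ht.1]
          have h2 : 1 + t ≤ b := by linarith [ht.2]
          exact mul_le_mul hρ1 h2 h1 (by norm_num)
        nlinarith
      gcongr
      exact ultraWeight_nonneg a ⟨by linarith [ht.1], by linarith [ht.2]⟩)
  refine le_trans (le_of_eq ?_) h
  have e1 : (b / 2) ^ (a - 3 / 2) * (-1 + b - (-1 + b / 2)) = (b / 2) ^ (a - 1 / 2) := by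
    rw [show -1 + b - (-1 + b / 2) = b / 2 by ring, ← Real.rpow_add_one (by positivity)]
    ring_nf
  have e2 : (b / 2) ^ (a - 1 / 2) = b ^ (a - 1 / 2) * (1 / 2) ^ (a - 1 / 2) := by
    rw [← Real.mul_rpow hb.le (by norm_num)]
    ring_nf
  have e3 : b ^ (-a) * b ^ (a - 1 / 2) = (Real.sqrt b)⁻¹ := by
    rw [← Real.rpow_add hb, Real.sqrt_eq_rpow, ← Real.rpow_neg hb.le]
    ring_nf
  calc _ = Real.Gamma a / 2 * Real.exp (-1) * (1 / 2) ^ (a - 1 / 2) *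
        (b ^ (-a) * b ^ (a - 1 / 2)) := by rw [e3]; ring
    _ = Real.Gamma a / 2 * Real.exp (-1) * b ^ (-a) *
        ((b / 2) ^ (a - 3 / 2) * (-1 + b - (-1 + b / 2))) := by rw [e1, e2]; ring
    _ = _ := by ring

/-- A shell of height `M` and width `h` contributes about `M h` to the next average, throughout a
fixed neighbourhood of `s = 1`. -/
theorem hankelGauss_succ_ge_of_ge {a b : ℝ} (ha : 3 / 2 ≤ a) (hb : 0 < b) {k : ℕ}
    (hk : (k : ℝ) = 2 * a - 1) (m : ℕ) {h M : ℝ} (hh : 0 < h) (hh1 : h ≤ 1 / 4) (hM : 0 ≤ M)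
    (hlow : ∀ s, |s - 1| ≤ h → M ≤ hankelGauss a k b m s) {s : ℝ} (hs : |s - 1| ≤ 1 / 4) :
    2 / 5 * (1 / 2) ^ (a - 3 / 2) * (M * h) ≤ ultraMass a * hankelGauss a k b (m + 1) s := by
  have hab := abs_le.1 hs
  have hs0 : 0 ≤ s := by linarith
  set ρ := Real.sqrt s with hρ
  have hρ0 : 0 ≤ ρ := Real.sqrt_nonneg s
  have hρs : ρ ^ 2 = s := Real.sq_sqrt hs0
  have hρ1 : ρ ≤ 5 / 4 := by nlinarith
  have hρ2 : 3 / 4 ≤ ρ := by nlinarith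
  have hlen : 2 / 5 * h ≤ h / (2 * ρ) := by
    rw [le_div_iff₀ (by positivity)]; nlinarith
  have hlen' : h / (2 * ρ) ≤ 1 / 6 := by
    rw [div_le_iff₀ (by positivity)]; nlinarith
  have hlen0 : 0 < h / (2 * ρ) := by positivity
  have hκ : (0 : ℝ) < (1 / 2) ^ (a - 3 / 2) := Real.rpow_pos_of_pos (by norm_num) _
  -- For these `t` the argument `1 + ρ² + 2ρt` runs through `[1, 1 + h]`, while `|t| ≤ 5/8` keeps `1
  -- - t²` above `1/2`.
  have hstep := hankelGauss_succ_ge ha hb hk m (u := -ρ / 2) (v := -ρ / 2 + h / (2 * ρ))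
    (c := (1 / 2) ^ (a - 3 / 2) * M) hs0 (by linarith) (by linarith) (by linarith) (by
      intro t ht
      have ht1 : -(5 / 8) ≤ t := by linarith [ht.1]
      have ht2 : t ≤ 0 := by linarith [ht.2]
      have hw : (1 / 2) ^ (a - 3 / 2) ≤ ultraWeight a t :=
        le_ultraWeight ha (by norm_num) (by nlinarith)
      refine mul_le_mul hw (hlow _ ?_) hM
        (ultraWeight_nonneg a ⟨by linarith, by linarith⟩)
      rw [← hρ, ← hρs, abs_le]
      have e : 2 * ρ * (-ρ / 2 + h / (2 * ρ)) = -ρ ^ 2 + h := by field_simp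
      have h1 : 2 * ρ * t ≤ -ρ ^ 2 + h := by
        rw [← e]; exact mul_le_mul_of_nonneg_left ht.2 (by positivity)
      have h2 : 2 * ρ * (-ρ / 2) ≤ 2 * ρ * t :=
        mul_le_mul_of_nonneg_left ht.1.le (by positivity)
      constructor <;> nlinarith)
  refine le_trans ?_ hstep
  have : 0 ≤ (1 / 2) ^ (a - 3 / 2) * M := by positivity
  calc _ = (1 / 2) ^ (a - 3 / 2) * M * (2 / 5 * h) := by ring
    _ ≤ _ := by
      refine mul_le_mul_of_nonneg_left ?_ this
      linarith

/-- A lower bound for the regularized Hankel transforms, uniform in the regularization. -/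
theorem exists_hankelGauss_ge {a : ℝ} (ha : 3 / 2 ≤ a) {k : ℕ} (hk : (k : ℝ) = 2 * a - 1)
    (m : ℕ) : ∃ C > 0, ∀ b, 0 < b → b ≤ 1 / 16 → ∀ s, |s - 1| ≤ 1 / 4 →
      C ≤ hankelGauss a k b (m + 2) s := by
  have hW := ultraMass_pos ha
  have hG := Real.Gamma_pos_of_pos (by linarith : 0 < a)
  have hκ : (0 : ℝ) < (1 / 2) ^ (a - 3 / 2) := Real.rpow_pos_of_pos (by norm_num) _
  have hκ' : (0 : ℝ) < (1 / 2) ^ (a - 1 / 2) := Real.rpow_pos_of_pos (by norm_num) _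
  induction m with
  | zero =>
    set c := Real.Gamma a / 2 * Real.exp (-1) * (1 / 2) ^ (a - 1 / 2) with hc
    have hc0 : 0 < c := by positivity
    refine ⟨2 / 5 * (1 / 2) ^ (a - 3 / 2) * (c / ultraMass a) / ultraMass a, by positivity,
      fun b hb hb1 s hs => ?_⟩
    have hsb : Real.sqrt b ^ 2 = b := Real.sq_sqrt hb.le
    have hsb0 : 0 < Real.sqrt b := Real.sqrt_pos.2 hb
    have hsb1 : Real.sqrt b ≤ 1 / 4 := by nlinarith
    -- Height `1/√b` times width `√b`: the dependence on `b` disappears here.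
    have h := hankelGauss_succ_ge_of_ge ha hb hk 1 (h := Real.sqrt b)
      (M := c / Real.sqrt b / ultraMass a) hsb0 hsb1 (by positivity) (fun s hs => by
        rw [div_le_iff₀ hW, mul_comm _ (ultraMass a)]
        exact hankelGauss_one_ge ha hb hb1 hk (by linarith [(abs_le.1 hs).1]) hs) hs
    rw [div_le_iff₀ hW, mul_comm _ (ultraMass a)]
    refine le_trans (le_of_eq ?_) h
    field_simp
  | succ m ih =>
    obtain ⟨C, hC, hlow⟩ := ih
    refine ⟨2 / 5 * (1 / 2) ^ (a - 3 / 2) * (C * (1 / 4)) / ultraMass a, by positivity,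
      fun b hb hb1 s hs => ?_⟩
    have h := hankelGauss_succ_ge_of_ge ha hb hk (m + 2) (h := 1 / 4) (M := C) (by norm_num)
      le_rfl hC.le (hlow b hb hb1) hs
    rw [div_le_iff₀ hW, mul_comm _ (ultraMass a)]
    exact h

/-- At `s = 1` the Bessel kernel is one more factor of the integrand, so `q - 1` factors inside the
transform give the power `q`. The uniform lower bound survives `b → 0` by dominated convergence. -/
theorem integral_besselBIntegrand_pos {a : ℝ} (ha : 3 / 2 ≤ a) {q k : ℕ}
    (hk : (k : ℝ) = 2 * a - 1) (hq : 3 ≤ q) (hqk : ¬(q = 3 ∧ k = 2)) :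
    0 < ∫ ψ in Ioi 0, besselBIntegrand a q k ψ := by
  obtain ⟨j, rfl⟩ := Nat.exists_eq_add_of_le hq
  obtain ⟨C, hC, hlow⟩ := exists_hankelGauss_ge ha hk j
  have hint := integrableOn_besselBIntegrand ha hk hq hqk
  have hlim : Tendsto (fun b : ℝ => ∫ ψ in Ioi 0, besselBIntegrand a (3 + j) k ψ *
      Real.exp (-b * ψ ^ 2)) (𝓝[>] 0) (𝓝 (∫ ψ in Ioi 0, besselBIntegrand a (3 + j) k ψ)) := by
    refine tendsto_integral_filter_of_dominated_convergence
      (fun ψ => ‖besselBIntegrand a (3 + j) k ψ‖) ?_ ?_ hint.norm ?_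
    · have := continuous_besselBIntegrand (by linarith : 1 ≤ a) (3 + j) k
      exact Eventually.of_forall fun b => (by fun_prop : Continuous _).aestronglyMeasurable
    · filter_upwards [self_mem_nhdsWithin] with b hb
      refine Eventually.of_forall fun ψ => ?_
      rw [norm_mul, Real.norm_of_nonneg (Real.exp_pos _).le]
      refine mul_le_of_le_one_right (norm_nonneg _) (Real.exp_le_one_iff.2 ?_)
      have : 0 < b := hb
      nlinarith [sq_nonneg ψ]
    · refine Eventually.of_forall fun ψ => ?_
      have hc : Continuous fun b : ℝ => besselBIntegrand a (3 + j) k ψ * Real.exp (-b * ψ ^ 2) := by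
        fun_prop
      have h0 : Tendsto _ (𝓝[>] (0 : ℝ)) _ := (hc.tendsto 0).mono_left nhdsWithin_le_nhds
      simpa using h0
  refine lt_of_lt_of_le hC (ge_of_tendsto hlim ?_)
  filter_upwards [Ioc_mem_nhdsGT (by norm_num : (0 : ℝ) < 1 / 16)] with b hb
  refine (hlow b hb.1 hb.2 1 (by norm_num)).trans (le_of_eq ?_)
  rw [hankelGauss]
  refine integral_congr_ae (Eventually.of_forall fun ψ => ?_)
  simp only [besselBIntegrand, mul_one]
  ring

/-! ### The exceptional case `d = q = 3` -/

theorem factorial_mul_poch_three_halves (m : ℕ) :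
    (4 : ℝ) ^ m * (m ! * poch (3 / 2) m) = (2 * m + 1)! := by
  induction m with
  | zero => simp [poch_zero]
  | succ m ih =>
    have e : 2 * (m + 1) + 1 = (2 * m + 1) + 1 + 1 := by ring
    rw [e, Nat.factorial_succ, Nat.factorial_succ, Nat.factorial_succ, poch_succ]
    push_cast
    rw [← ih]
    ring

theorem besselB_three_halves (x : ℝ) : besselB (3 / 2) (x ^ 2) = Real.sinc x := by
  rcases eq_or_ne x 0 with rfl | hx
  · simp [besselB_zero]
  rw [Real.sinc_of_ne_zero hx, eq_div_iff hx]
  refine ((hasSum_besselB (by norm_num) (x ^ 2)).mul_right x).unique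
    ((Real.hasSum_sin x).congr_fun fun m => ?_)
  have h := factorial_mul_poch_three_halves m
  have hp := (poch_pos (a := 3 / 2) (by norm_num) m).ne'
  rw [besselTerm, ← h, show -x ^ 2 / 4 = (-1) * x ^ 2 / 4 by ring, div_pow, mul_pow, ← pow_mul,
    pow_succ]
  field_simp

/-- The difference `D` of the two sides satisfies `D'' = -(n + 1)² D` with zero initial data, so its
conserved energy vanishes. -/
theorem sin_mul_gegAngle_three_halves (n : ℕ) (θ : ℝ) :
    Real.sin θ * gegAngle (3 / 2) n θ = Real.sin ((n + 1) * θ) / (n + 1) := by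
  have hN : (n : ℝ) + 1 ≠ 0 := by positivity
  let D : ℝ → ℝ := fun θ => Real.sin θ * gegAngle (3 / 2) n θ - Real.sin ((n + 1) * θ) / (n + 1)
  let D1 : ℝ → ℝ := fun θ => Real.cos θ * gegAngle (3 / 2) n θ +
    Real.sin θ * gegAngleDeriv (3 / 2) n θ - Real.cos ((n + 1) * θ)
  have hlin : ∀ x : ℝ, HasDerivAt (fun x : ℝ => (n + 1) * x) ((n : ℝ) + 1) x := fun x => by
    simpa using (hasDerivAt_id x).const_mul ((n : ℝ) + 1)
  have h1 : ∀ x, HasDerivAt D (D1 x) x := fun x =>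
    (((Real.hasDerivAt_sin x).mul (hasDerivAt_gegAngle (3 / 2) n x)).sub
      ((hlin x).sin.div_const _)).congr_deriv (by simp only [D1]; field_simp)
  have h2 : ∀ x, HasDerivAt D1 (-((n + 1) ^ 2 * D x)) x := fun x =>
    ((((Real.hasDerivAt_cos x).mul (hasDerivAt_gegAngle (3 / 2) n x)).add
      ((Real.hasDerivAt_sin x).mul (hasDerivAt_gegAngleDeriv (3 / 2) n x))).sub
      (hlin x).cos).congr_deriv (by
        have hode := gegAngle_ode (a := 3 / 2) (by norm_num) n x
        have e : (n + 1) ^ 2 * (Real.sin ((n + 1) * x) / (n + 1)) =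
            (n + 1) * Real.sin ((n + 1) * x) := by field_simp
        simp only [D]
        linear_combination hode - e)
  have h3 : ∀ x, HasDerivAt (fun x => D1 x ^ 2 + (n + 1) ^ 2 * D x ^ 2) 0 x := fun x =>
    (((h2 x).pow 2).add (((h1 x).pow 2).const_mul (((n : ℝ) + 1) ^ 2))).congr_deriv
      (by simp; ring)
  have hconst := is_const_of_deriv_eq_zero (fun x => (h3 x).differentiableAt)
    (fun x => (h3 x).deriv) θ 0
  have h4 : D1 θ ^ 2 + (n + 1) ^ 2 * D θ ^ 2 = 0 := by
    rw [hconst]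
    simp [D, D1, gegAngle_zero]
  have h5 : ((n + 1) * D θ) ^ 2 = 0 := by
    nlinarith [sq_nonneg (D1 θ), sq_nonneg ((n + 1) * D θ)]
  have h6 : D θ = 0 := by
    simpa [hN] using h5
  exact sub_eq_zero.1 h6

theorem besselBIntegrand_three {x : ℝ} (hx : x ≠ 0) :
    besselBIntegrand (3 / 2) 3 2 x = Real.sin x ^ 3 / x := by
  rw [besselBIntegrand, besselB_three_halves, Real.sinc_of_ne_zero hx]
  field_simp

/-- `sin³` has a bounded antiderivative `C`; integrating by parts on `[1, R]` replaces `sin³ x / x`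
by the absolutely integrable `C(x)/x²` and boundary terms. -/
theorem exists_tendsto_integral_sin_cube_div :
    ∃ I, Tendsto (fun R : ℝ => ∫ x in (0)..R, besselBIntegrand (3 / 2) 3 2 x) atTop (𝓝 I) := by
  have hg := continuous_besselBIntegrand (a := 3 / 2) (by norm_num) 3 2
  let C : ℝ → ℝ := fun x => -Real.cos x + Real.cos x ^ 3 / 3
  have hC : ∀ x, HasDerivAt C (Real.sin x ^ 3) x := fun x =>
    ((Real.hasDerivAt_cos x).neg.add (((Real.hasDerivAt_cos x).pow 3).div_const 3)).congr_deriv (by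
      have := Real.sin_sq_add_cos_sq x
      simp
      linear_combination -Real.sin x * this)
  have hCc : Continuous C := by simp only [C]; fun_prop
  have hCb : ∀ x, |C x| ≤ 2 := by
    intro x
    have h1 := Real.abs_cos_le_one x
    have h2 : |Real.cos x| ^ 3 ≤ 1 := pow_le_one₀ (abs_nonneg _) h1
    calc |C x| ≤ |-Real.cos x| + |Real.cos x ^ 3 / 3| := abs_add_le _ _
      _ = |Real.cos x| + |Real.cos x| ^ 3 / 3 := by
        rw [abs_neg, abs_div, abs_pow, abs_of_pos (by norm_num : (0 : ℝ) < 3)]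
      _ ≤ 2 := by linarith
  have hint : IntegrableOn (fun x => C x / x ^ 2) (Ioi 1) := by
    have hdom : IntegrableOn (fun x : ℝ => 2 * x ^ (-2 : ℝ)) (Ioi 1) :=
      (integrableOn_Ioi_rpow_of_lt (by norm_num) one_pos).const_mul 2
    refine Integrable.mono' hdom ?_ ?_
    · exact (hCc.measurable.div (measurable_id.pow_const 2)).aestronglyMeasurable
    · filter_upwards [ae_restrict_mem measurableSet_Ioi] with x hx
      have hx0 : (0 : ℝ) < x := lt_trans one_pos hx
      rw [norm_div, Real.norm_of_nonneg (by positivity : 0 ≤ x ^ 2), Real.rpow_neg hx0.le,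
        Real.rpow_two, ← div_eq_mul_inv]
      gcongr
      exact hCb x
  have hparts : ∀ R : ℝ, 1 ≤ R → ∫ x in (0)..R, besselBIntegrand (3 / 2) 3 2 x =
      (∫ x in (0)..1, besselBIntegrand (3 / 2) 3 2 x) +
        (C R / R - C 1 + ∫ x in (1)..R, C x / x ^ 2) := by
    intro R hR
    rw [← intervalIntegral.integral_add_adjacent_intervals (hg.intervalIntegrable 0 1)
      (hg.intervalIntegrable 1 R)]
    congr 1
    have hpos : ∀ x ∈ uIcc 1 R, x ≠ 0 := by
      intro x hx
      rw [uIcc_of_le hR] at hx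
      linarith [hx.1]
    have hi : IntervalIntegrable (fun x => C x / x ^ 2) volume 1 R :=
      (hCc.continuousOn.div (by fun_prop) fun x hx => pow_ne_zero 2 (hpos x hx)).intervalIntegrable
    have hderiv : ∀ x ∈ uIcc 1 R, HasDerivAt (fun x => C x / x)
        (besselBIntegrand (3 / 2) 3 2 x - C x / x ^ 2) x := by
      intro x hx
      have hx0 := hpos x hx
      refine ((hC x).div (hasDerivAt_id x) hx0).congr_deriv ?_
      rw [besselBIntegrand_three hx0]
      simp only [id]
      field_simp
    have h := intervalIntegral.integral_eq_sub_of_hasDerivAt hderiv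
      ((hg.intervalIntegrable 1 R).sub hi)
    rw [intervalIntegral.integral_sub (hg.intervalIntegrable 1 R) hi] at h
    simp only [div_one] at h
    linarith
  have hlim1 : Tendsto (fun R : ℝ => C R / R) atTop (𝓝 0) := by
    refine squeeze_zero_norm' (a := fun R : ℝ => 2 / R) ?_ (tendsto_const_nhds.div_atTop tendsto_id)
    filter_upwards [eventually_gt_atTop 0] with R hR
    rw [norm_div, Real.norm_of_nonneg hR.le]
    gcongr
    exact hCb R
  have hlim2 := intervalIntegral_tendsto_integral_Ioi 1 hint tendsto_id
  refine ⟨_, (((hlim1.sub_const (C 1)).add hlim2).const_add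
    (∫ x in (0)..1, besselBIntegrand (3 / 2) 3 2 x)).congr' ?_⟩
  filter_upwards [eventually_ge_atTop 1] with R hR
  exact (hparts R hR).symm

theorem tendsto_integral_sin_mul (f : ℝ → ℝ) (hf : Integrable f) :
    Tendsto (fun L : ℝ => ∫ v, Real.sin (L * v) * f v) atTop (𝓝 0) := by
  have hpi := Real.pi_pos
  have h := Real.tendsto_integral_exp_smul_cocompact (fun v => (f v : ℂ))
  have hscale : Tendsto (fun L : ℝ => L / (2 * Real.pi)) atTop (cocompact ℝ) :=
    -- The Fourier character carries a factor `2π`, hence the frequency `L/(2π)`; the sine integral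
    -- is minus the imaginary part.
    (tendsto_id.atTop_div_const (by positivity)).mono_right atTop_le_cocompact
  have h2 := (Complex.continuous_im.tendsto 0).comp (h.comp hscale)
  simp only [Complex.zero_im] at h2
  have h3 := h2.neg
  rw [neg_zero] at h3
  refine h3.congr fun L => ?_
  simp only [Function.comp_apply]
  have hint : Integrable fun v : ℝ => Real.fourierChar (-(v * (L / (2 * Real.pi)))) • (f v : ℂ) := by
    have hf' : Integrable fun v => (f v : ℂ) := hf.ofReal
    refine hf'.mono ?_ (Eventually.of_forall fun v => by simp)
    have hc : Continuous fun v : ℝ => Real.fourierChar (-(v * (L / (2 * Real.pi)))) :=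
      Real.continuous_fourierChar.comp (by fun_prop)
    exact hc.aestronglyMeasurable.smul hf'.aestronglyMeasurable
  have him := integral_im hint
  simp only [RCLike.im_to_complex] at him
  rw [← him, ← integral_neg]
  refine integral_congr_ae (Eventually.of_forall fun v => ?_)
  have e : 2 * Real.pi * -(v * (L / (2 * Real.pi))) = -(L * v) := by field_simp
  simp only [Circle.smul_def, Real.fourierChar_apply, e, smul_eq_mul, Complex.im_mul_ofReal,
    Complex.exp_ofReal_mul_I_im, Real.sin_neg]
  ring

/-- The poles of `1/sin θ` and `1/θ` at `0` cancel, so the difference is an integrable amplitude for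
the Riemann–Lebesgue lemma. -/
theorem abs_inv_sin_sub_inv_le {θ : ℝ} (h0 : 0 < θ) (h1 : θ ≤ Real.pi / 2) :
    |(Real.sin θ)⁻¹ - θ⁻¹| ≤ 2 := by
  have hpi := Real.pi_pos
  have hpi4 := Real.pi_le_four
  have hs := Real.mul_le_sin h0.le h1
  have hs0 : 0 < Real.sin θ := lt_of_lt_of_le (by positivity) hs
  have hsle := Real.sin_le h0.le
  have hhalf : θ / 2 ≤ Real.sin θ := by
    refine le_trans ?_ hs
    rw [div_mul_eq_mul_div, div_le_div_iff₀ two_pos hpi]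
    nlinarith
  have e : (Real.sin θ)⁻¹ - θ⁻¹ = (θ - Real.sin θ) / (Real.sin θ * θ) := by
    field_simp
  rw [e, abs_of_nonneg (div_nonneg (by linarith) (by positivity)), div_le_iff₀ (by positivity)]
  rcases le_or_gt θ 1 with h | h
  · have h3 := Real.sin_gt_sub_cube h0
    have h4 : θ ^ 3 ≤ θ ^ 2 := by nlinarith [sq_nonneg θ]
    nlinarith
  · nlinarith

theorem integrableOn_sin_pow_mul_sub (L : ℝ) :
    IntegrableOn (fun θ => Real.sin (L * θ) ^ 3 * ((Real.sin θ)⁻¹ - θ⁻¹))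
      (Ioc 0 (Real.pi / 2)) := by
  refine Integrable.mono' (integrableOn_const (C := (2 : ℝ)) (by simp)) ?_ ?_
  · refine Measurable.aestronglyMeasurable ?_
    fun_prop
  · filter_upwards [ae_restrict_mem measurableSet_Ioc] with θ hθ
    have h1 : |Real.sin (L * θ)| ^ 3 ≤ 1 := pow_le_one₀ (abs_nonneg _) (Real.abs_sin_le_one _)
    rw [norm_mul, norm_pow, Real.norm_eq_abs, Real.norm_eq_abs]
    calc _ ≤ 1 * 2 := mul_le_mul h1 (abs_inv_sin_sub_inv_le hθ.1 hθ.2) (abs_nonneg _) zero_le_one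
      _ = 2 := one_mul 2

theorem tendsto_integral_sin_cube_mul_sub :
    Tendsto (fun L : ℝ => ∫ θ in Ioc 0 (Real.pi / 2),
      Real.sin (L * θ) ^ 3 * ((Real.sin θ)⁻¹ - θ⁻¹)) atTop (𝓝 0) := by
  let f : ℝ → ℝ := (Ioc 0 (Real.pi / 2)).indicator fun θ => (Real.sin θ)⁻¹ - θ⁻¹
  have hf : Integrable f := by
    refine (integrable_indicator_iff measurableSet_Ioc).2 ?_
    refine Integrable.mono' (integrableOn_const (C := (2 : ℝ)) (by simp)) ?_ ?_
    · refine Measurable.aestronglyMeasurable ?_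
      fun_prop
    · filter_upwards [ae_restrict_mem measurableSet_Ioc] with θ hθ
      exact abs_inv_sin_sub_inv_le hθ.1 hθ.2
  have h1 := (tendsto_integral_sin_mul f hf).const_mul (3 / 4)
  have h2 := ((tendsto_integral_sin_mul f hf).comp
    (tendsto_id.const_mul_atTop (by norm_num : (0 : ℝ) < 3))).const_mul (1 / 4)
  have h := h1.sub h2
  rw [mul_zero, mul_zero, sub_zero] at h
  have hint : ∀ L : ℝ, Integrable fun θ => Real.sin (L * θ) * f θ := fun L =>
    hf.bdd_mul (c := 1) (by fun_prop) (Eventually.of_forall fun θ => Real.abs_sin_le_one _)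
  refine h.congr fun L => ?_
  simp only [Function.comp_apply, id]
  rw [← integral_const_mul, ← integral_const_mul,
    ← integral_sub ((hint L).const_mul _) ((hint _).const_mul _),
    ← integral_indicator measurableSet_Ioc]
  refine integral_congr_ae (Eventually.of_forall fun θ => ?_)
  simp only [f, indicator_apply]
  split_ifs
  · rw [mul_assoc 3 L θ, Real.sin_three_mul]
    ring
  · simp

theorem cube_mul_integral_gegAngle (n : ℕ) :
    ((n : ℝ) + 1) ^ 3 * ∫ θ in (0)..(Real.pi / 2), gegAngle (3 / 2) n θ ^ 3 * Real.sin θ ^ 2 =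
      ∫ θ in Ioc 0 (Real.pi / 2), Real.sin ((n + 1) * θ) ^ 3 / Real.sin θ := by
  rw [intervalIntegral.integral_of_le (by positivity), ← integral_const_mul]
  refine setIntegral_congr_fun measurableSet_Ioc fun θ hθ => ?_
  have hs : Real.sin θ ≠ 0 :=
    (Real.sin_pos_of_pos_of_lt_pi hθ.1 (by linarith [hθ.2, Real.pi_pos])).ne'
  have hN : (n : ℝ) + 1 ≠ 0 := by positivity
  have h := sin_mul_gegAngle_three_halves n θ
  rw [eq_div_iff hN] at h
  rw [← h]
  field_simp

theorem integral_sin_cube_div_sin_eq {L : ℝ} (hL : 0 < L) :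
    ∫ θ in Ioc 0 (Real.pi / 2), Real.sin (L * θ) ^ 3 / Real.sin θ =
      (∫ x in (0)..(L * (Real.pi / 2)), besselBIntegrand (3 / 2) 3 2 x) +
        ∫ θ in Ioc 0 (Real.pi / 2), Real.sin (L * θ) ^ 3 * ((Real.sin θ)⁻¹ - θ⁻¹) := by
  have hg := continuous_besselBIntegrand (a := 3 / 2) (by norm_num) 3 2
  have hcomp := intervalIntegral.integral_comp_mul_left (a := 0) (b := Real.pi / 2)
    (besselBIntegrand (3 / 2) 3 2) hL.ne'
  rw [mul_zero, smul_eq_mul, eq_inv_mul_iff_mul_eq₀ hL.ne',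
    intervalIntegral.integral_of_le (by positivity), ← integral_const_mul] at hcomp
  have hgi : IntegrableOn (fun θ => L * besselBIntegrand (3 / 2) 3 2 (L * θ))
      (Ioc 0 (Real.pi / 2)) :=
    ((by fun_prop : Continuous fun θ => L * besselBIntegrand (3 / 2) 3 2 (L * θ)).integrableOn_Icc
      ).mono_set Ioc_subset_Icc_self
  rw [← hcomp, ← integral_add hgi (integrableOn_sin_pow_mul_sub L)]
  refine setIntegral_congr_fun measurableSet_Ioc fun θ hθ => ?_
  have hθ0 : θ ≠ 0 := hθ.1.ne'
  rw [besselBIntegrand_three (mul_ne_zero hL.ne' hθ0)]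
  field_simp
  ring

/-- This is the Dirichlet kernel: consecutive integrands differ by `2 cos((2m + 2)θ)`, whose
integral over `(0, π/2]` is zero. -/
theorem integral_sin_odd_div_sin (m : ℕ) :
    IntegrableOn (fun θ => Real.sin ((2 * m + 1) * θ) / Real.sin θ) (Ioc 0 (Real.pi / 2)) ∧
      ∫ θ in Ioc 0 (Real.pi / 2), Real.sin ((2 * m + 1) * θ) / Real.sin θ = Real.pi / 2 := by
  have hpi := Real.pi_pos
  have hs : ∀ θ ∈ Ioc 0 (Real.pi / 2), Real.sin θ ≠ 0 := fun θ hθ =>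
    (Real.sin_pos_of_pos_of_lt_pi hθ.1 (by linarith [hθ.2])).ne'
  induction m with
  | zero =>
    have e : EqOn (fun _ : ℝ => (1 : ℝ))
        (fun θ => Real.sin ((2 * (0 : ℕ) + 1) * θ) / Real.sin θ) (Ioc 0 (Real.pi / 2)) := by
      intro θ hθ
      simp [hs θ hθ]
    constructor
    · exact IntegrableOn.congr_fun (integrableOn_const (by simp)) e measurableSet_Ioc
    · rw [← setIntegral_congr_fun measurableSet_Ioc e]
      simp [Measure.real]
      positivity
  | succ m ih =>
    have e : EqOn (fun θ : ℝ => Real.sin ((2 * m + 1) * θ) / Real.sin θ +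
        2 * Real.cos ((2 * m + 2) * θ))
        (fun θ => Real.sin ((2 * (m + 1 : ℕ) + 1) * θ) / Real.sin θ) (Ioc 0 (Real.pi / 2)) := by
      intro θ hθ
      have h0 := hs θ hθ
      have h1 : Real.sin ((2 * (m + 1 : ℕ) + 1) * θ) =
          Real.sin ((2 * m + 1) * θ) + 2 * Real.cos ((2 * m + 2) * θ) * Real.sin θ := by
        have e1 : (2 * ((m + 1 : ℕ) : ℝ) + 1) * θ = (2 * m + 2) * θ + θ := by push_cast; ring
        have e2 : (2 * (m : ℝ) + 1) * θ = (2 * m + 2) * θ - θ := by ring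
        rw [e1, e2, Real.sin_add, Real.sin_sub]
        ring
      simp only
      rw [h1]
      field_simp
    have hci : IntegrableOn (fun θ : ℝ => 2 * Real.cos ((2 * m + 2) * θ))
        (Ioc 0 (Real.pi / 2)) :=
      ((by fun_prop : Continuous fun θ : ℝ => 2 * Real.cos ((2 * m + 2) * θ)).integrableOn_Icc
        ).mono_set Ioc_subset_Icc_self
    have hc : ∫ θ in Ioc 0 (Real.pi / 2), 2 * Real.cos ((2 * m + 2) * θ) = 0 := by
      have hm : (2 * (m : ℝ) + 2) ≠ 0 := by positivity
      rw [← intervalIntegral.integral_of_le (by positivity), intervalIntegral.integral_const_mul,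
        intervalIntegral.integral_comp_mul_left (fun x => Real.cos x) hm, integral_cos]
      have e1 : (2 * (m : ℝ) + 2) * (Real.pi / 2) = ((m + 1 : ℕ) : ℝ) * Real.pi := by
        push_cast; ring
      rw [e1, Real.sin_nat_mul_pi]
      simp
    constructor
    · exact IntegrableOn.congr_fun (ih.1.add hci) e measurableSet_Ioc
    · rw [← setIntegral_congr_fun measurableSet_Ioc e, integral_add ih.1 hci, ih.2, hc, add_zero]

theorem integral_sin_odd_cube_div_sin (m : ℕ) :
    ∫ θ in Ioc 0 (Real.pi / 2), Real.sin ((2 * m + 1) * θ) ^ 3 / Real.sin θ = Real.pi / 4 := by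
  obtain ⟨i1, h1⟩ := integral_sin_odd_div_sin m
  -- The triple-angle formula needs the frequency `3(2m + 1) = 2(3m + 1) + 1`, which is again odd.
  obtain ⟨i2, h2⟩ := integral_sin_odd_div_sin (3 * m + 1)
  have e : ∀ θ : ℝ, Real.sin ((2 * m + 1) * θ) ^ 3 / Real.sin θ =
      3 / 4 * (Real.sin ((2 * m + 1) * θ) / Real.sin θ) -
        1 / 4 * (Real.sin ((2 * (3 * m + 1 : ℕ) + 1) * θ) / Real.sin θ) := by
    intro θ
    have e1 : (2 * ((3 * m + 1 : ℕ) : ℝ) + 1) * θ = 3 * ((2 * m + 1) * θ) := by push_cast; ring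
    rw [e1, Real.sin_three_mul]
    ring
  simp_rw [e]
  rw [integral_sub (i1.const_mul _) (i2.const_mul _), integral_const_mul, integral_const_mul,
    h1, h2]
  ring

/-- In the exceptional case the limit of the rescaled moments is `π / 4`. -/
theorem tendsto_cube_mul_integral_gegAngle {I : ℝ}
    (hI : Tendsto (fun R : ℝ => ∫ x in (0)..R, besselBIntegrand (3 / 2) 3 2 x) atTop (𝓝 I)) :
    I = Real.pi / 4 ∧ Tendsto (fun n : ℕ => (n : ℝ) ^ 3 *
      ∫ θ in (0)..(Real.pi / 2), gegAngle (3 / 2) n θ ^ 3 * Real.sin θ ^ 2) atTop (𝓝 I) := by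
  have hpi := Real.pi_pos
  have hL : Tendsto (fun L : ℝ => ∫ θ in Ioc 0 (Real.pi / 2),
      Real.sin (L * θ) ^ 3 / Real.sin θ) atTop (𝓝 I) := by
    have h := (hI.comp (tendsto_id.atTop_mul_const (by positivity : 0 < Real.pi / 2))).add
      tendsto_integral_sin_cube_mul_sub
    rw [add_zero] at h
    refine h.congr' ?_
    filter_upwards [eventually_gt_atTop 0] with L hL
    exact (integral_sin_cube_div_sin_eq hL).symm
  constructor
  -- The limit over real `L` exists, so it may be computed along odd integers, where the integral is
  -- constantly `π/4`.
  · have hodd : Tendsto (fun m : ℕ => 2 * (m : ℝ) + 1) atTop atTop :=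
      tendsto_atTop_add_const_right _ _ (tendsto_natCast_atTop_atTop.const_mul_atTop two_pos)
    have h := hL.comp hodd
    simp only [Function.comp_def, integral_sin_odd_cube_div_sin] at h
    exact tendsto_nhds_unique h tendsto_const_nhds |>.trans rfl
  · have hn1 : Tendsto (fun n : ℕ => (n : ℝ) + 1) atTop atTop :=
      tendsto_atTop_add_const_right _ _ tendsto_natCast_atTop_atTop
    have h := ((tendsto_natCast_div_add_atTop (1 : ℝ)).pow 3).mul (hL.comp hn1)
    rw [one_pow, one_mul] at h
    refine h.congr fun n => ?_
    have hN : (n : ℝ) + 1 ≠ 0 := by positivity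
    simp only [Function.comp_apply]
    rw [← cube_mul_integral_gegAngle]
    field_simp

/-- Adding the translate by `π/2` pairs `|sin x|³` with `|cos x|³`, whose sum is at least `1/2`;
since `x + π/2 ≤ 3x` for `x > 1`, integrability would force that of `1/x`. -/
theorem not_integrableOn_sin_cube_div :
    ¬ IntegrableOn (besselBIntegrand (3 / 2) 3 2) (Ioi 0) := by
  intro h
  have hpi := Real.pi_pos
  have hpi4 := Real.pi_le_four
  let H : ℝ → ℝ := (Ioi 0).indicator fun x => |besselBIntegrand (3 / 2) 3 2 x|
  have hH : Integrable H := (integrable_indicator_iff measurableSet_Ioi).2 h.abs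
  have hsum := (hH.add (hH.comp_add_right (Real.pi / 2))).integrableOn (s := Ioi 1)
  refine not_integrableOn_Ioi_inv (a := 1) (Integrable.mono' (hsum.const_mul 6)
    measurable_inv.aestronglyMeasurable ?_)
  filter_upwards [ae_restrict_mem measurableSet_Ioi] with x hx
  have hx1 : 1 < x := hx
  have hx0 : 0 < x := by linarith
  have hxp : 0 < x + Real.pi / 2 := by linarith
  simp only [Pi.add_apply, H]
  rw [indicator_of_mem (mem_Ioi.2 hx0), indicator_of_mem (mem_Ioi.2 hxp),
    besselBIntegrand_three hx0.ne', besselBIntegrand_three hxp.ne', Real.sin_add_pi_div_two,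
    abs_div, abs_div, abs_pow, abs_pow, abs_of_pos hx0, abs_of_pos hxp, norm_inv,
    Real.norm_of_nonneg hx0.le]
  have hsc : 1 / 2 ≤ |Real.sin x| ^ 3 + |Real.cos x| ^ 3 := by
    have hs1 := Real.abs_sin_le_one x
    have hc1 := Real.abs_cos_le_one x
    have h2 : |Real.sin x| ^ 2 + |Real.cos x| ^ 2 = 1 := by
      rw [sq_abs, sq_abs]; exact Real.sin_sq_add_cos_sq x
    have h3 : |Real.sin x| ^ 4 ≤ |Real.sin x| ^ 3 :=
      pow_le_pow_of_le_one (abs_nonneg _) hs1 (by norm_num)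
    have h4 : |Real.cos x| ^ 4 ≤ |Real.cos x| ^ 3 :=
      pow_le_pow_of_le_one (abs_nonneg _) hc1 (by norm_num)
    nlinarith [sq_nonneg (|Real.sin x| ^ 2 - |Real.cos x| ^ 2)]
  have h5 : |Real.sin x| ^ 3 / (3 * x) ≤ |Real.sin x| ^ 3 / x := by
    gcongr; linarith
  have h6 : |Real.cos x| ^ 3 / (3 * x) ≤ |Real.cos x| ^ 3 / (x + Real.pi / 2) := by
    gcongr; linarith
  calc x⁻¹ = 6 * ((1 / 2) / (3 * x)) := by field_simp; norm_num
    _ ≤ 6 * ((|Real.sin x| ^ 3 + |Real.cos x| ^ 3) / (3 * x)) := by gcongr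
    _ = 6 * (|Real.sin x| ^ 3 / (3 * x) + |Real.cos x| ^ 3 / (3 * x)) := by rw [add_div]
    _ ≤ _ := by gcongr

/-! ### Return to `J` and conclusion -/

theorem besselJ_eq {ν x : ℝ} (hν : 0 ≤ ν) (hx : 0 < x) :
    besselJ ν x = (x / 2) ^ ν / Real.Gamma (ν + 1) * besselB (ν + 1) (x ^ 2) := by
  rw [besselJ, besselB, ← tsum_mul_left]
  refine tsum_congr fun m => ?_
  have hG := (Real.Gamma_pos_of_pos (by linarith : 0 < ν + 1)).ne'
  have hp := (poch_pos (by linarith : 1 ≤ ν + 1) m).ne'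
  have hf : (m ! : ℝ) ≠ 0 := by positivity
  have hG2 : Real.Gamma (m + ν + 1) = poch (ν + 1) m * Real.Gamma (ν + 1) := by
    rw [← Gamma_add_nat (by linarith)]; ring_nf
  have hpow : (x / 2) ^ (2 * (m : ℝ) + ν) = (x ^ 2 / 4) ^ m * (x / 2) ^ ν := by
    rw [Real.rpow_add (by positivity), show 2 * (m : ℝ) = ((2 * m : ℕ) : ℝ) by push_cast; rfl,
      Real.rpow_natCast, pow_mul]
    congr 2
    ring
  rw [besselTerm, hG2, hpow, show -x ^ 2 / 4 = (-1) * (x ^ 2 / 4) by ring, mul_pow (-1 : ℝ)]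
  field_simp

/-- The normalizing constant `2^(d/2-1) Γ(d/2)`. -/
noncomputable def besselScale (d : ℕ) : ℝ :=
  (2 : ℝ) ^ ((d : ℝ) / 2 - 1) * Real.Gamma ((d : ℝ) / 2)

theorem besselScale_pos {d : ℕ} (hd : 3 ≤ d) : 0 < besselScale d := by
  have hd' : (3 : ℝ) ≤ d := by exact_mod_cast hd
  exact mul_pos (Real.rpow_pos_of_pos two_pos _) (Real.Gamma_pos_of_pos (by linarith))

/-- The power `ψ^(-q(d/2 - 1))` cancels the leading behaviour of `J^q` at `0`, which leaves a
function continuous up to the origin; the constant is exactly the one divided out in `cConst`. -/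
theorem besselIntegrand_eq (q : ℕ) {d : ℕ} (hd : 3 ≤ d) {ψ : ℝ} (hψ : 0 < ψ) :
    besselIntegrand q d ψ =
      (besselScale d ^ q)⁻¹ * besselBIntegrand ((d : ℝ) / 2) q (d - 1) ψ := by
  have hd' : (3 : ℝ) ≤ d := by exact_mod_cast hd
  have hG := (Real.Gamma_pos_of_pos (by linarith : 0 < (d : ℝ) / 2)).ne'
  have h2 := (Real.rpow_pos_of_pos two_pos ((d : ℝ) / 2 - 1)).ne'
  have hψν := (Real.rpow_pos_of_pos hψ ((d : ℝ) / 2 - 1)).ne'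
  have hexp : ψ ^ (-(q : ℝ) * ((d : ℝ) / 2 - 1) + d - 1) =
      ((ψ ^ ((d : ℝ) / 2 - 1)) ^ q)⁻¹ * ψ ^ (d - 1) := by
    rw [← Real.rpow_natCast (ψ ^ ((d : ℝ) / 2 - 1)) q, ← Real.rpow_mul hψ.le, ← Real.rpow_neg hψ.le,
      ← Real.rpow_natCast ψ (d - 1), ← Real.rpow_add hψ, Nat.cast_sub (by omega)]
    congr 1
    push_cast
    ring
  rw [besselIntegrand, besselJ_eq (by linarith) hψ, sub_add_cancel, hexp, besselBIntegrand,
    besselScale, Real.div_rpow hψ.le two_pos.le, mul_pow, div_pow, div_pow, mul_pow]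
  field_simp

theorem integrableOn_besselIntegrand_Ioc (q : ℕ) {d : ℕ} (hd : 3 ≤ d) (R : ℝ) :
    IntegrableOn (besselIntegrand q d) (Ioc 0 R) := by
  have hd' : (3 : ℝ) ≤ d := by exact_mod_cast hd
  have hg := continuous_besselBIntegrand (by linarith : 1 ≤ (d : ℝ) / 2) q (d - 1)
  exact (((hg.const_smul (besselScale d ^ q)⁻¹).integrableOn_Icc (a := 0) (b := R)).mono_set
    Ioc_subset_Icc_self).congr_fun (fun ψ hψ => (besselIntegrand_eq q hd hψ.1).symm)
      measurableSet_Ioc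

theorem integrableOn_besselIntegrand_iff (q : ℕ) {d : ℕ} (hd : 3 ≤ d) :
    IntegrableOn (besselIntegrand q d) (Ioi 0) ↔
      IntegrableOn (besselBIntegrand ((d : ℝ) / 2) q (d - 1)) (Ioi 0) := by
  have hK : (besselScale d ^ q)⁻¹ ≠ 0 := inv_ne_zero (pow_ne_zero _ (besselScale_pos hd).ne')
  have hcongr : EqOn (besselIntegrand q d)
      (fun ψ => (besselScale d ^ q)⁻¹ * besselBIntegrand ((d : ℝ) / 2) q (d - 1) ψ) (Ioi 0) :=
    fun ψ hψ => besselIntegrand_eq q hd hψ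
  rw [integrableOn_congr_fun hcongr measurableSet_Ioi]
  exact integrable_const_mul_iff hK.isUnit _

theorem tendsto_integral_besselIntegrand (q : ℕ) {d : ℕ} (hd : 3 ≤ d) {I : ℝ}
    (hI : Tendsto (fun R : ℝ => ∫ x in (0)..R, besselBIntegrand ((d : ℝ) / 2) q (d - 1) x) atTop
      (𝓝 I)) :
    Tendsto (fun R : ℝ => ∫ x in (0)..R, besselIntegrand q d x) atTop
      (𝓝 ((besselScale d ^ q)⁻¹ * I)) := by
  refine (hI.const_mul _).congr' ?_
  filter_upwards [eventually_ge_atTop 0] with R hR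
  rw [intervalIntegral.integral_of_le hR, intervalIntegral.integral_of_le hR,
    ← integral_const_mul]
  exact setIntegral_congr_fun measurableSet_Ioc
    fun ψ hψ => (besselIntegrand_eq q hd hψ.1).symm

theorem gegenbauerG_cos {d : ℕ} (hd : 3 ≤ d) (n : ℕ) (θ : ℝ) :
    gegenbauerG n d (Real.cos θ) = gegAngle ((d : ℝ) / 2) n θ :=
  gegenbauerG_eq_eval hd n _

/-- Convergence of the normalized integral to a nonzero limit, and of the rescaled moments to the
same limit. -/
theorem exists_limit_ne_zero {q d : ℕ} (hq : 3 ≤ q) (hd : 3 ≤ d) :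
    ∃ I : ℝ, I ≠ 0 ∧
      Tendsto (fun R : ℝ => ∫ x in (0)..R, besselBIntegrand ((d : ℝ) / 2) q (d - 1) x) atTop
        (𝓝 I) ∧
      Tendsto (fun n : ℕ => (n : ℝ) ^ d * ∫ θ in (0)..(Real.pi / 2),
        gegAngle ((d : ℝ) / 2) n θ ^ q * Real.sin θ ^ (d - 1)) atTop (𝓝 I) := by
  by_cases hqd : q = 3 ∧ d = 3
  · obtain ⟨rfl, rfl⟩ := hqd
    obtain ⟨I, hI⟩ := exists_tendsto_integral_sin_cube_div
    obtain ⟨hval, hlim⟩ := tendsto_cube_mul_integral_gegAngle hI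
    have hpi := Real.pi_pos
    push_cast
    exact ⟨I, by rw [hval]; positivity, hI, hlim⟩
  · have hd' : (3 : ℝ) ≤ d := by exact_mod_cast hd
    have ha : 3 / 2 ≤ (d : ℝ) / 2 := by linarith
    have hk : ((d - 1 : ℕ) : ℝ) = 2 * ((d : ℝ) / 2) - 1 := by
      rw [Nat.cast_sub (by omega)]; push_cast; ring
    have hqk : ¬(q = 3 ∧ d - 1 = 2) := by omega
    have hlim := tendsto_pow_mul_integral_gegAngle ha hk hq hqk
    rw [Nat.sub_add_cancel (by omega)] at hlim
    exact ⟨_, (integral_besselBIntegrand_pos ha hk hq hqk).ne',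
      intervalIntegral_tendsto_integral_Ioi 0 (integrableOn_besselBIntegrand ha hk hq hqk)
        tendsto_id, hlim⟩

theorem proposition1 (q d : ℕ) (hq : 3 ≤ q) (hd : 3 ≤ d) :
    ((fun ℓ : ℕ => ∫ θ in (0)..(Real.pi / 2),
        gegenbauerG ℓ d (Real.cos θ) ^ q * Real.sin θ ^ (d - 1))
      ~[atTop] fun ℓ : ℕ => cConst q d / (ℓ : ℝ) ^ d) ∧
    HasImproperIntegral (besselIntegrand q d) (improperIntegral (besselIntegrand q d)) ∧
    ((d, q) ≠ (3, 3) → ConvergesAbsolutely (besselIntegrand q d)) ∧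
    ((d, q) = (3, 3) → ConvergesConditionally (besselIntegrand q d)) := by
  obtain ⟨I, hI0, hI, hlim⟩ := exists_limit_ne_zero hq hd
  have hd' : (3 : ℝ) ≤ d := by exact_mod_cast hd
  have hJ := tendsto_integral_besselIntegrand q hd hI
  have himp : improperIntegral (besselIntegrand q d) = (besselScale d ^ q)⁻¹ * I := hJ.limUnder_eq
  have hK : besselScale d ^ q ≠ 0 := pow_ne_zero _ (besselScale_pos hd).ne'
  have hc : cConst q d = I := by
    rw [cConst, himp, ← besselScale, mul_inv_cancel_left₀ hK]
  have hconv : HasImproperIntegral (besselIntegrand q d)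
      (improperIntegral (besselIntegrand q d)) :=
    ⟨integrableOn_besselIntegrand_Ioc q hd, himp ▸ hJ⟩
  refine ⟨?_, hconv, fun h => ?_, fun h => ⟨⟨_, hconv⟩, ?_⟩⟩
  -- The quotient of the two sequences is eventually the rescaled moment divided by `I`; this is
  -- where `I ≠ 0` is indispensable.
  · refine isEquivalent_of_tendsto_one ?_
    have h1 := hlim.div_const I
    rw [div_self hI0] at h1
    refine h1.congr' ?_
    filter_upwards [eventually_gt_atTop 0] with n hn
    have hn' : (n : ℝ) ≠ 0 := by positivity
    simp only [Pi.div_apply, gegenbauerG_cos hd, hc]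
    field_simp
  · refine (integrableOn_besselIntegrand_iff q hd).2 (integrableOn_besselBIntegrand (by linarith)
      ?_ hq ?_)
    · rw [Nat.cast_sub (by omega)]; push_cast; ring
    · rintro ⟨rfl, hd2⟩
      exact h (by rw [show d = 3 by omega])
  · obtain ⟨rfl, rfl⟩ := Prod.mk.inj h
    rw [ConvergesAbsolutely, integrableOn_besselIntegrand_iff 3 le_rfl]
    exact_mod_cast not_integrableOn_sin_cube_div
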